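/- **Setting.** Let $n\ge 1$, $p\ge 0$ be integers and let $\mathcal G=(\{1,\dots,n\},\mathcal E)$ be a strongly connected directed graph, where $(i,j)\in\mathcal E$ means that agent $j$ can send information to agent $i$. Let $A=(a_{ij})\in\mathbb R^{n\times n}$ satisfy $a_{ij}>0$ if $j=i$ or $(i,j)\in\mathcal E$, $a_{ij}=0$ otherwise, and $\sum_j a_{ij}=1$ for all $i$. Let $f_1,\dots,f_n:\mathbb R^p\to\mathbb R$ be differentiable and let $s,l>0$ be such that for all $i$ and all $u,v\in\mathbb R^p$ $$f_i(u)-f_i(v)\le\nabla f_i(u)^\top(u-v)-\tfrac s2\|u-v\|_2^2,\qquad \|\nabla f_i(u)-\nabla f_i(v)\|_2\le l\|u-v\|_2 .$$ Let $\alpha>0$. Put $Y_0=I_n$, $Y_{k+1}=AY_k$. Starting from arbitrary $x_{0,i}\in\mathbb R^p$ and $z_{0,i}=\nabla f_i(x_{0,i})$, define for $k\ge0$ $$x_{k+1,i}=\sum_j a_{ij}x_{k,j}-\alpha z_{k,i},\qquad z_{k+1,i}=\sum_j a_{ij}z_{k,j}+\frac{\nabla f_i(x_{k+1,i})}{(Y_{k+1})_{ii}}-\frac{\nabla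 f_i(x_{k,i})}{(Y_k)_{ii}} .$$ Write $\mathbf x_k=(x_{k,i})_i$, $\mathbf z_k=(z_{k,i})_i$, $\nabla\mathbf f_k=(\nabla f_i(x_{k,i}))_i\in(\mathbb R^{p})^n$. An $n\times n$ matrix $M$ acts on $(\mathbb R^p)^n$ by $(M\mathbf v)_i=\sum_jM_{ij}v_j$; $\|\cdot\|_2$ is the Euclidean norm of vectors and the spectral norm of matrices, and $\operatorname{diag}(M)$ is the diagonal part of $M$. Put $$Y_\infty=\lim_{k\to\infty}Y_k,\quad \widetilde Y_k=\operatorname{diag}(Y_k),\quad \widetilde Y_\infty=\operatorname{diag}(Y_\infty),\quad \widehat{\mathbf x}_k=Y_\infty\mathbf x_k,\quad \widehat{\mathbf z}_k=Y_\infty\mathbf z_k,$$ $$\tau=\|A-I_n\|_2,\quad \epsilon=\|I_n-Y_\infty\|_2,\quad \eta=\max(|1-\alpha nl|,|1-\alpha ns|),\quad y=\sup_{k}\|Y_k\|_2,\quad \widetilde y=\sup_k\|\widetilde Y_k^{-1}\|_2,$$ and let $\mathbf x^*=(x^*,\dots,x^*)$, where $x^*$ is the minimizer of $\sum_i f_i$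 over $\mathbb R^p$. **Theorem.** The limit $Y_\infty$ exists, all $\widetilde Y_k$ and $\widetilde Y_\infty$ are invertible, $y$ and $\widetilde y$ are finite, and the minimizer $x^*$ exists and is unique. There are a norm $\|\cdot\|$ on $(\mathbb R^p)^n$ and constants $\sigma,\gamma_1\in(0,1)$, $c,d,\widetilde T>0$, depending only on $A$ and $p$, such that 1. $\|A\mathbf a-Y_\infty\mathbf a\|\le\sigma\|\mathbf a-Y_\infty\mathbf a\|$, $\|\mathbf a\|_2\le c\|\mathbf a\|$ and $\|\mathbf a\|\le d\|\mathbf a\|_2$ for all $\mathbf a\in(\mathbb R^p)^n$; 2. for some $T>0$, $\|Y_k-Y_\infty\|_2\le T\gamma_1^k$ for all $k\ge0$; 3. $\|\widetilde Y_k^{-1}-\widetilde Y_\infty^{-1}\|_2\le\widetilde y^2\widetilde T\gamma_1^k$ and $\|\widetilde Y_{k+1}^{-1}-\widetilde Y_k^{-1}\|_2\le2\widetilde y^2\widetilde T\gamma_1^k$ for all $k\ge0$. For every choice of a norm and constants in these ranges with properties 1–3, the vectors $\mathbf t_k=(\|\mathbf x_k-\widehat{\mathbf x}_k\|,\ \|\widehat{\mathbf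 x}_k-\mathbf x^*\|_2,\ \|\mathbf z_k-\widehat{\mathbf z}_k\|)^\top$ and $\mathbf s_k=(\|\nabla\mathbf f_k\|_2,0,0)^\top$ satisfy, entrywise, $$\mathbf t_{k+1}\le G\,\mathbf t_k+H_k\,\mathbf s_k\qquad\text{for all }k\ge0,$$ where $$G=\begin{pmatrix}\sigma&0&\alpha\\ \alpha cnl&\eta&0\\ cd\epsilon\widetilde yl(\tau+\alpha nl)&\alpha d\epsilon l^2\widetilde yn&\sigma+\alpha cd\epsilon l\widetilde y\end{pmatrix},\qquad H_k=\begin{pmatrix}0&0&0\\ \alpha y\widetilde y^2\widetilde T\gamma_1^k&0&0\\ (\alpha\epsilon\widetilde yly+2\epsilon)d\widetilde y^2\widetilde T\gamma_1^k&0&0\end{pmatrix},$$ and all entries of $G$ are nonnegative. -/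

import Mathlib

open Filter Topology

namespace DistOpt

noncomputable section

/-- A directed graph is strongly connected if every vertex is reachable from every vertex. -/
def StronglyConnected {V : Type*} (𝒢 : Digraph V) : Prop :=
  ∀ i j : V, Relation.ReflTransGen 𝒢.Adj i j

/-- Row-stochastic weights compatible with the graph, where `𝒢.Adj i j` means that agent `j` can
send information to agent `i`: the weight `A i j` is positive if `j` is `i` itself or an
in-neighbour of `i`, it is zero otherwise, and every row sums to one. -/
structure IsWeightMatrix {n : ℕ} (𝒢 : Digraph (Fin n)) (A : Matrix (Fin n) (Fin n) ℝ) : Prop where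
  pos : ∀ i j, (j = i ∨ 𝒢.Adj i j) → 0 < A i j
  zero : ∀ i j, ¬ (j = i ∨ 𝒢.Adj i j) → A i j = 0
  row_sum : ∀ i, ∑ j, A i j = 1

/-- Stacked vectors `(v_1, …, v_n)` with `v_i ∈ ℝ^p`; the norm is the Euclidean norm of `ℝ^(np)`. -/
abbrev Stack (n p : ℕ) : Type := PiLp 2 (fun _ : Fin n => EuclideanSpace ℝ (Fin p))

/-- The action of an `n × n` matrix on stacked vectors, `(M v)_i = ∑_j M_ij v_j`
(that is, multiplication by `M ⊗ I_p`; for `p = 1`, by `M`). -/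
def act {n p : ℕ} (M : Matrix (Fin n) (Fin n) ℝ) (v : Stack n p) : Stack n p :=
  WithLp.toLp 2 fun i => ∑ j, M i j • v j

/-- The stacked vector all of whose blocks are `x`. -/
def constStack (n : ℕ) {p : ℕ} (x : EuclideanSpace ℝ (Fin p)) : Stack n p :=
  WithLp.toLp 2 fun _ => x

/-- The spectral norm `‖M‖₂` of a matrix. -/
def norm2 {n : ℕ} (M : Matrix (Fin n) (Fin n) ℝ) : ℝ :=
  ‖Matrix.toEuclideanCLM (𝕜 := ℝ) M‖

/-! ### The matrices `Y_k` and the constants derived from `A` -/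

/-- The matrix `Y_k`, whose `i`-th row is the vector `y_{k,i}` of agent `i`. -/
def Y {n : ℕ} (A : Matrix (Fin n) (Fin n) ℝ) : ℕ → Matrix (Fin n) (Fin n) ℝ
  | 0 => 1
  | k + 1 => A * Y A k

/-- `Y_∞ = lim_k Y_k`. -/
def Yinf {n : ℕ} (A : Matrix (Fin n) (Fin n) ℝ) : Matrix (Fin n) (Fin n) ℝ :=
  limUnder atTop (Y A)

/-- The diagonal part `diag(M)` of a square matrix. -/
def diagPart {n : ℕ} (M : Matrix (Fin n) (Fin n) ℝ) : Matrix (Fin n) (Fin n) ℝ :=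
  Matrix.diagonal fun i => M i i

/-- `τ = ‖A - I‖₂`. -/
def tau {n : ℕ} (A : Matrix (Fin n) (Fin n) ℝ) : ℝ := norm2 (A - 1)

/-- `ε = ‖I - Y_∞‖₂`. -/
def eps {n : ℕ} (A : Matrix (Fin n) (Fin n) ℝ) : ℝ := norm2 (1 - Yinf A)

/-- `y = sup_k ‖Y_k‖₂`. -/
def ySup {n : ℕ} (A : Matrix (Fin n) (Fin n) ℝ) : ℝ := ⨆ k, norm2 (Y A k)

/-- `ỹ = sup_k ‖diag(Y_k)⁻¹‖₂`. -/
def yTil {n : ℕ} (A : Matrix (Fin n) (Fin n) ℝ) : ℝ := ⨆ k, norm2 ((diagPart (Y A k))⁻¹)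

/-- `η = max(|1 - α n l|, |1 - α n s|)`. -/
def eta (n : ℕ) (α s l : ℝ) : ℝ := max |1 - α * n * l| |1 - α * n * s|

/-- The limits and suprema above are genuine ones: `Y_k` converges to `Y_∞`, all the matrices
`diag(Y_k)` and `diag(Y_∞)` are invertible, and both suprema are finite. -/
structure WellDefined {n : ℕ} (A : Matrix (Fin n) (Fin n) ℝ) : Prop where
  tendsto : Tendsto (Y A) atTop (𝓝 (Yinf A))
  isUnit : ∀ k, IsUnit (diagPart (Y A k))
  isUnit_inf : IsUnit (diagPart (Yinf A))
  bdd : BddAbove (Set.range fun k => norm2 (Y A k))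
  bdd_inv : BddAbove (Set.range fun k => norm2 ((diagPart (Y A k))⁻¹))

/-- The constants that are not given by a closed formula: a norm `N` on stacked vectors in which
`A` contracts towards `Y_∞` with factor `σ`, constants `c`, `d` of equivalence between `N` and the
Euclidean norm, a geometric rate `γ` of the convergence `Y_k → Y_∞`, and a constant `T` for the
convergence of the inverted diagonal parts at this rate. They depend on `A` (and `p`) only. -/
structure IsConstants {n p : ℕ} (A : Matrix (Fin n) (Fin n) ℝ) (N : Seminorm ℝ (Stack n p))
    (σ c d γ T : ℝ) : Prop where
  definite : ∀ v, N v = 0 → v = 0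
  σ_pos : 0 < σ
  σ_lt_one : σ < 1
  contract : ∀ a, N (act A a - act (Yinf A) a) ≤ σ * N (a - act (Yinf A) a)
  c_pos : 0 < c
  norm_le : ∀ v, ‖v‖ ≤ c * N v
  d_pos : 0 < d
  le_norm : ∀ v, N v ≤ d * ‖v‖
  γ_pos : 0 < γ
  γ_lt_one : γ < 1
  rate : ∃ T₀ : ℝ, 0 < T₀ ∧ ∀ k, norm2 (Y A k - Yinf A) ≤ T₀ * γ ^ k
  T_pos : 0 < T
  rate_inv : ∀ k, norm2 ((diagPart (Y A k))⁻¹ - (diagPart (Yinf A))⁻¹) ≤ yTil A ^ 2 * T * γ ^ k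
  rate_inv_succ : ∀ k, norm2 ((diagPart (Y A (k + 1)))⁻¹ - (diagPart (Y A k))⁻¹) ≤
    2 * yTil A ^ 2 * T * γ ^ k

/-! ### The objective functions and the algorithm -/

/-- Differentiable, strongly convex with constant `s > 0`, with `l`-Lipschitz gradients, `l > 0`. -/
structure IsObjective {n p : ℕ} (f : Fin n → EuclideanSpace ℝ (Fin p) → ℝ) (s l : ℝ) : Prop where
  differentiable : ∀ i, Differentiable ℝ (f i)
  s_pos : 0 < s
  l_pos : 0 < l
  strong : ∀ i x₁ x₂, f i x₁ - f i x₂ ≤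
    inner ℝ (gradient (f i) x₁) (x₁ - x₂) - s / 2 * ‖x₁ - x₂‖ ^ 2
  lipschitz : ∀ i x₁ x₂, ‖gradient (f i) x₁ - gradient (f i) x₂‖ ≤ l * ‖x₁ - x₂‖

/-- `x` is a global minimizer of `∑_i f_i`. -/
def IsOptimal {n p : ℕ} (f : Fin n → EuclideanSpace ℝ (Fin p) → ℝ)
    (x : EuclideanSpace ℝ (Fin p)) : Prop :=
  ∀ w, ∑ i, f i x ≤ ∑ i, f i w

/-- The stacked gradient `(∇f_1(v_1), …, ∇f_n(v_n))`. -/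
def gradStack {n p : ℕ} (f : Fin n → EuclideanSpace ℝ (Fin p) → ℝ) (v : Stack n p) : Stack n p :=
  WithLp.toLp 2 fun i => gradient (f i) (v i)

/-- The pair `(x_k, z_k)` of iterates of the algorithm with step-size `α`, started at `x₀`. -/
def iter {n p : ℕ} (A : Matrix (Fin n) (Fin n) ℝ) (f : Fin n → EuclideanSpace ℝ (Fin p) → ℝ)
    (α : ℝ) (x₀ : Stack n p) : ℕ → Stack n p × Stack n p
  | 0 => (x₀, gradStack f x₀)
  | k + 1 =>
    let x := (iter A f α x₀ k).1
    let z := (iter A f α x₀ k).2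
    let x' : Stack n p := WithLp.toLp 2 fun i => (∑ j, A i j • x j) - α • z i
    (x', WithLp.toLp 2 fun i => (∑ j, A i j • z j) + (Y A (k + 1) i i)⁻¹ • gradient (f i) (x' i)
      - (Y A k i i)⁻¹ • gradient (f i) (x i))

/-- `x_k`. -/
def xSeq {n p : ℕ} (A : Matrix (Fin n) (Fin n) ℝ) (f : Fin n → EuclideanSpace ℝ (Fin p) → ℝ)
    (α : ℝ) (x₀ : Stack n p) (k : ℕ) : Stack n p := (iter A f α x₀ k).1

/-- `z_k`. -/
def zSeq {n p : ℕ} (A : Matrix (Fin n) (Fin n) ℝ) (f : Fin n → EuclideanSpace ℝ (Fin p) → ℝ)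
    (α : ℝ) (x₀ : Stack n p) (k : ℕ) : Stack n p := (iter A f α x₀ k).2

/-! ### The linear recursion -/

/-- `t_k = (‖x_k - x̂_k‖, ‖x̂_k - x*‖₂, ‖z_k - ẑ_k‖)` with `x̂_k = Y_∞ x_k`, `ẑ_k = Y_∞ z_k`. -/
def tVec {n p : ℕ} (A : Matrix (Fin n) (Fin n) ℝ) (N : Seminorm ℝ (Stack n p))
    (f : Fin n → EuclideanSpace ℝ (Fin p) → ℝ) (α : ℝ) (x₀ : Stack n p)
    (xs : EuclideanSpace ℝ (Fin p)) (k : ℕ) : Fin 3 → ℝ :=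
  ![N (xSeq A f α x₀ k - act (Yinf A) (xSeq A f α x₀ k)),
    ‖act (Yinf A) (xSeq A f α x₀ k) - constStack n xs‖,
    N (zSeq A f α x₀ k - act (Yinf A) (zSeq A f α x₀ k))]

/-- `s_k = (‖∇f_k‖₂, 0, 0)`. -/
def sVec {n p : ℕ} (A : Matrix (Fin n) (Fin n) ℝ)
    (f : Fin n → EuclideanSpace ℝ (Fin p) → ℝ) (α : ℝ) (x₀ : Stack n p) (k : ℕ) : Fin 3 → ℝ :=
  ![‖gradStack f (xSeq A f α x₀ k)‖, 0, 0]

/-- The matrix `G`. -/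
def GMat {n : ℕ} (A : Matrix (Fin n) (Fin n) ℝ) (α s l σ c d : ℝ) : Matrix (Fin 3) (Fin 3) ℝ :=
  !![σ, 0, α;
     α * c * n * l, eta n α s l, 0;
     c * d * eps A * yTil A * l * (tau A + α * n * l),
       α * d * eps A * l ^ 2 * yTil A * n,
       σ + α * c * d * eps A * l * yTil A]

/-- The matrix `H_k`. -/
def HMat {n : ℕ} (A : Matrix (Fin n) (Fin n) ℝ) (α l d γ T : ℝ) (k : ℕ) :
    Matrix (Fin 3) (Fin 3) ℝ :=
  !![0, 0, 0;
     (α * ySup A * yTil A ^ 2 * T) * γ ^ k, 0, 0;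
     (α * eps A * yTil A * l * ySup A + 2 * eps A) * d * yTil A ^ 2 * T * γ ^ k, 0, 0]

end

end DistOpt

open DistOpt

namespace DistOpt

/-! ### Powers of the weight matrix -/

/-! Here `Y A k = A ^ k`, and strong connectivity with positive self-loops makes `A` primitive.
Doeblin's contraction gives geometric convergence to a matrix with identical rows `π`, where `π` is
a positive probability vector and `π A = π` (`exists_limit`, `Yinf_pos`). On disagreements `a - Y_∞
a` the matrix `A` acts as `A - Y_∞`, whose powers decay geometrically. A weighted sum of finitely
many iterates then gives a norm in which it contracts in one step (`exists_adapted_norm`).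

Since `Y_∞ A = Y_∞`, averaging the tracking recursion telescopes to `Y_∞ z_k = Y_∞ diag(Y_k)⁻¹ ∇f_k`
(`act_Yinf_zSeq`). Moreover `Y_∞ diag(Y_∞)⁻¹` is the all-ones matrix, so `Y_∞ z_k` is the stacked
sum of the local gradients up to an error of order `γ ^ k ‖∇f_k‖`. The average `Y_∞ x_k` therefore
performs inexact gradient descent on `∑ f_i`. The exact step is `η`-Lipschitz by cocoercivity
(`norm_gradient_step_le`); the errors come from disagreement and from the unfinished estimate of
`π`. The tracking row needs in addition only a bound on `x_{k+1} - x_k`, because the innovation in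
`z` is a difference of scaled gradients. -/

lemma Y_eq_pow {n : ℕ} (A : Matrix (Fin n) (Fin n) ℝ) (k : ℕ) : Y A k = A ^ k := by
  induction k with
  | zero => simp [Y]
  | succ k ih => rw [Y, ih, pow_succ']

lemma IsWeightMatrix.nonneg {n : ℕ} {𝒢 : Digraph (Fin n)} {A : Matrix (Fin n) (Fin n) ℝ}
    (hA : IsWeightMatrix 𝒢 A) (i j : Fin n) : 0 ≤ A i j := by
  by_cases h : j = i ∨ 𝒢.Adj i j
  · exact (hA.pos i j h).le
  · exact (hA.zero i j h).ge

lemma IsWeightMatrix.pow_nonneg {n : ℕ} {𝒢 : Digraph (Fin n)} {A : Matrix (Fin n) (Fin n) ℝ}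
    (hA : IsWeightMatrix 𝒢 A) (k : ℕ) (i j : Fin n) : 0 ≤ (A ^ k) i j := by
  induction k generalizing i j with
  | zero =>
    rw [pow_zero, Matrix.one_apply]
    split_ifs <;> norm_num
  | succ k ih =>
    rw [pow_succ', Matrix.mul_apply]
    exact Finset.sum_nonneg fun r _ => mul_nonneg (hA.nonneg _ _) (ih _ _)

lemma IsWeightMatrix.pow_row_sum {n : ℕ} {𝒢 : Digraph (Fin n)} {A : Matrix (Fin n) (Fin n) ℝ}
    (hA : IsWeightMatrix 𝒢 A) (k : ℕ) (i : Fin n) : ∑ j, (A ^ k) i j = 1 := by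
  induction k generalizing i with
  | zero => simp [Matrix.one_apply]
  | succ k ih =>
    simp only [pow_succ', Matrix.mul_apply]
    rw [Finset.sum_comm]
    simp only [← Finset.mul_sum, ih, mul_one, hA.row_sum]

/-- Self-loops let a walk be prolonged by waiting at `i`, so a positive entry stays positive. This
is the source of aperiodicity. -/
lemma IsWeightMatrix.pow_pos_of_le {n : ℕ} {𝒢 : Digraph (Fin n)} {A : Matrix (Fin n) (Fin n) ℝ}
    (hA : IsWeightMatrix 𝒢 A) {i j : Fin n} {k m : ℕ} (hkm : k ≤ m) (h : 0 < (A ^ k) i j) :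
    0 < (A ^ m) i j := by
  induction m, hkm using Nat.le_induction with
  | base => exact h
  | succ m _ ih =>
    rw [pow_succ', Matrix.mul_apply]
    exact Finset.sum_pos' (fun r _ => mul_nonneg (hA.nonneg _ _) (hA.pow_nonneg _ _ _))
      ⟨i, Finset.mem_univ _, mul_pos (hA.pos _ _ (Or.inl rfl)) ih⟩

lemma IsWeightMatrix.pow_diag_pos {n : ℕ} {𝒢 : Digraph (Fin n)} {A : Matrix (Fin n) (Fin n) ℝ}
    (hA : IsWeightMatrix 𝒢 A) (k : ℕ) (i : Fin n) : 0 < (A ^ k) i i :=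
  hA.pow_pos_of_le (Nat.zero_le k) (by simp)

/-- The weight matrix of a strongly connected graph is primitive. -/
lemma IsWeightMatrix.eventually_pow_pos {n : ℕ} {𝒢 : Digraph (Fin n)}
    {A : Matrix (Fin n) (Fin n) ℝ} (hA : IsWeightMatrix 𝒢 A) (h𝒢 : StronglyConnected 𝒢) :
    ∀ᶠ m : ℕ in atTop, ∀ i j, 0 < (A ^ m) i j := by
  rw [eventually_all]; intro i
  rw [eventually_all]; intro j
  have h : ∃ k : ℕ, 0 < (A ^ k) i j := by
    induction h𝒢 i j using Relation.ReflTransGen.head_induction_on with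
    | refl => exact ⟨0, by simp⟩
    | @head a b hab _ ih =>
      obtain ⟨k, hk⟩ := ih
      refine ⟨k + 1, ?_⟩
      rw [pow_succ', Matrix.mul_apply]
      exact Finset.sum_pos' (fun r _ => mul_nonneg (hA.nonneg _ _) (hA.pow_nonneg _ _ _))
        ⟨b, Finset.mem_univ _, mul_pos (hA.pos _ _ (Or.inr hab)) hk⟩
  obtain ⟨k, hk⟩ := h
  exact eventually_atTop.2 ⟨k, fun m hm => hA.pow_pos_of_le hm hk⟩

/-- Doeblin's contraction: a stochastic matrix with entries at least `δ` contracts the `ℓ¹` norm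
of row vectors with zero sum by the factor `1 - n δ`. -/
lemma sum_abs_vecMul_le {n : ℕ} {P : Matrix (Fin n) (Fin n) ℝ} {δ : ℝ}
    (hP : ∀ i j, δ ≤ P i j) (hrow : ∀ i, ∑ j, P i j = 1) {v : Fin n → ℝ} (hv : ∑ i, v i = 0) :
    ∑ j, |(Matrix.vecMul v P) j| ≤ (1 - n * δ) * ∑ i, |v i| := by
  -- As `v` sums to zero, `δ` may be subtracted from every entry of `P`, which leaves a nonnegative
  -- matrix with row sums `1 - n δ`.
  have key : ∀ j, Matrix.vecMul v P j = ∑ i, v i * (P i j - δ) := by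
    intro j
    simp only [Matrix.vecMul, dotProduct, mul_sub, Finset.sum_sub_distrib, ← Finset.sum_mul, hv]
    ring
  calc ∑ j, |(Matrix.vecMul v P) j| ≤ ∑ j, ∑ i, |v i| * (P i j - δ) := by
        refine Finset.sum_le_sum fun j _ => ?_
        rw [key]
        refine (Finset.abs_sum_le_sum_abs _ _).trans_eq (Finset.sum_congr rfl fun i _ => ?_)
        rw [abs_mul, abs_of_nonneg (sub_nonneg.2 (hP i j))]
    _ = (1 - n * δ) * ∑ i, |v i| := by
        rw [Finset.sum_comm, Finset.mul_sum]
        refine Finset.sum_congr rfl fun i _ => ?_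
        rw [← Finset.mul_sum, Finset.sum_sub_distrib, hrow]
        simp [mul_comm]

lemma sum_vecMul_eq {n : ℕ} {P : Matrix (Fin n) (Fin n) ℝ}
    (hrow : ∀ i, ∑ j, P i j = 1) (v : Fin n → ℝ) :
    ∑ j, (Matrix.vecMul v P) j = ∑ i, v i := by
  simp only [Matrix.vecMul, dotProduct]
  rw [Finset.sum_comm]
  simp only [← Finset.mul_sum, hrow, mul_one]

/-- Geometric decay of `v A ^ k` for row vectors `v` with zero sum. -/
lemma IsWeightMatrix.exists_geometric {n : ℕ} {𝒢 : Digraph (Fin n)}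
    {A : Matrix (Fin n) (Fin n) ℝ} (hA : IsWeightMatrix 𝒢 A) (h𝒢 : StronglyConnected 𝒢) :
    ∃ γ C : ℝ, 0 < γ ∧ γ < 1 ∧ 0 < C ∧ ∀ v : Fin n → ℝ, ∑ i, v i = 0 → ∀ k : ℕ,
      ∑ j, |(Matrix.vecMul v (A ^ k)) j| ≤ C * γ ^ k * ∑ i, |v i| := by
  obtain ⟨m, hm, hm1⟩ := ((hA.eventually_pow_pos h𝒢).and (eventually_ge_atTop 1)).exists
  -- The bound `n δ < 1` keeps the block factor `q = 1 - n δ` positive, so that it has an inverse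
  -- and a positive `m`-th root.
  have hδ : ∀ᶠ δ : ℝ in 𝓝[>] 0, (∀ i j, δ ≤ (A ^ m) i j) ∧ n * δ < 1 := by
    refine ((eventually_all.2 fun i => eventually_all.2 fun j => ?_).and ?_)
    · exact ((tendsto_id.eventually (gt_mem_nhds (hm i j))).mono fun x hx => le_of_lt hx).filter_mono
        nhdsWithin_le_nhds
    · have : Tendsto (fun δ : ℝ => n * δ) (𝓝 0) (𝓝 (n * 0)) := tendsto_id.const_mul _
      rw [mul_zero] at this
      exact (this.eventually (gt_mem_nhds one_pos)).filter_mono nhdsWithin_le_nhds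
  obtain ⟨δ, ⟨hδ1, hδ2⟩, hδ0 : 0 < δ⟩ := (hδ.and self_mem_nhdsWithin).exists
  by_cases hn : n = 0
  · subst hn
    exact ⟨1 / 2, 1, by norm_num, by norm_num, one_pos, fun v _ k => by simp⟩
  have hn' : (0 : ℝ) < n := by exact_mod_cast Nat.pos_of_ne_zero hn
  set q : ℝ := 1 - n * δ with hq
  have hq0 : 0 < q := by linarith
  have hq1 : q < 1 := by have := mul_pos hn' hδ0; linarith
  have hm0 : m ≠ 0 := by omega
  have one : ∀ v : Fin n → ℝ, ∑ i, v i = 0 → ∀ k : ℕ,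
      ∑ j, |(Matrix.vecMul v (A ^ k)) j| ≤ ∑ i, |v i| := fun v hv k => by
    simpa using sum_abs_vecMul_le (hA.pow_nonneg k) (hA.pow_row_sum k) hv
  have blk : ∀ v : Fin n → ℝ, ∑ i, v i = 0 → ∀ t : ℕ,
      ∑ j, |(Matrix.vecMul v (A ^ (m * t))) j| ≤ q ^ t * ∑ i, |v i| := by
    intro v hv t
    induction t with
    | zero => simp
    | succ t ih =>
      rw [Nat.mul_succ, pow_add, ← Matrix.vecMul_vecMul]
      refine (sum_abs_vecMul_le hδ1 (hA.pow_row_sum m)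
        ((sum_vecMul_eq (hA.pow_row_sum _) v).trans hv)).trans ?_
      rw [pow_succ', mul_assoc]
      exact mul_le_mul_of_nonneg_left ih hq0.le
  set γ : ℝ := q ^ ((1 : ℝ) / m) with hγ
  have hγ0 : 0 < γ := Real.rpow_pos_of_pos hq0 _
  have hγ1 : γ < 1 := Real.rpow_lt_one hq0.le hq1 (by positivity)
  have hγm : γ ^ m = q := by
    rw [hγ, one_div]; exact Real.rpow_inv_natCast_pow hq0.le hm0
  -- Only the `k / m` full blocks contract; the remaining `k % m` steps are merely nonexpansive. The
  -- constant `q⁻¹ = γ ^ (-m)` pays for them.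
  refine ⟨γ, q⁻¹, hγ0, hγ1, inv_pos.2 hq0, fun v hv k => ?_⟩
  have hk : A ^ k = A ^ (m * (k / m)) * A ^ (k % m) := by
    rw [← pow_add, Nat.div_add_mod]
  rw [hk, ← Matrix.vecMul_vecMul]
  refine (one _ ((sum_vecMul_eq (hA.pow_row_sum _) v).trans hv) _).trans ((blk v hv _).trans ?_)
  refine mul_le_mul_of_nonneg_right ?_ (Finset.sum_nonneg fun _ _ => abs_nonneg _)
  rw [le_inv_mul_iff₀ hq0, ← pow_succ', ← hγm, ← pow_mul]
  refine pow_le_pow_of_le_one hγ0.le hγ1.le ?_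
  have := Nat.div_add_mod k m
  have := Nat.mod_lt k (Nat.pos_of_ne_zero hm0)
  rw [Nat.mul_succ]; omega

/-- The powers of `A` converge entrywise, geometrically fast. -/
lemma IsWeightMatrix.exists_limit {n : ℕ} {𝒢 : Digraph (Fin n)}
    {A : Matrix (Fin n) (Fin n) ℝ} (hA : IsWeightMatrix 𝒢 A) (h𝒢 : StronglyConnected 𝒢) :
    ∃ γ C : ℝ, 0 < γ ∧ γ < 1 ∧ 0 < C ∧ Tendsto (Y A) atTop (𝓝 (Yinf A)) ∧
      (∀ k i j, |Y A k i j - Yinf A i j| ≤ C * γ ^ k) ∧ ∀ i i' j, Yinf A i j = Yinf A i' j := by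
  obtain ⟨γ, C, hγ0, hγ1, hC, h⟩ := hA.exists_geometric h𝒢
  have step : ∀ i j k, dist ((A ^ k) i j) ((A ^ (k + 1)) i j) ≤ (C * 2) * γ ^ k := by
    intro i j k
    -- Row `i` of `A - 1`: its image under `A ^ k` is row `i` of `A ^ (k + 1) - A ^ k`.
    set v : Fin n → ℝ := fun r => A i r - (1 : Matrix (Fin n) (Fin n) ℝ) i r with hv
    have hv0 : ∑ r, v r = 0 := by simp [hv, Finset.sum_sub_distrib, hA.row_sum, Matrix.one_apply]
    have hv2 : ∑ r, |v r| ≤ 2 := by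
      calc ∑ r, |v r| ≤ ∑ r, (A i r + (1 : Matrix (Fin n) (Fin n) ℝ) i r) := by
            refine Finset.sum_le_sum fun r _ => (abs_sub _ _).trans_eq ?_
            rw [abs_of_nonneg (hA.nonneg i r), abs_of_nonneg]
            rw [Matrix.one_apply]; split_ifs <;> norm_num
        _ = 2 := by
            rw [Finset.sum_add_distrib, hA.row_sum]
            simp [Matrix.one_apply]; norm_num
    have hvk : Matrix.vecMul v (A ^ k) j = (A ^ (k + 1)) i j - (A ^ k) i j := by
      have : v = (A - 1) i := rfl
      rw [this, ← Matrix.mul_apply_eq_vecMul, sub_mul, one_mul, ← pow_succ', Matrix.sub_apply]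
    rw [dist_comm, Real.dist_eq, ← hvk]
    refine (Finset.single_le_sum (f := fun j => |Matrix.vecMul v (A ^ k) j|)
      (fun _ _ => abs_nonneg _) (Finset.mem_univ j)).trans ((h v hv0 k).trans ?_)
    have : 0 ≤ C * γ ^ k := by positivity
    nlinarith
  have hlim : ∀ i j, ∃ x, Tendsto (fun k => (A ^ k) i j) atTop (𝓝 x) := fun i j =>
    cauchySeq_tendsto_of_complete (cauchySeq_of_le_geometric γ _ hγ1 (step i j))
  choose L hL using hlim
  have hT : Tendsto (Y A) atTop (𝓝 (Matrix.of L)) := by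
    refine tendsto_pi_nhds.2 fun i => tendsto_pi_nhds.2 fun j => ?_
    simp only [Y_eq_pow]
    exact hL i j
  have hY : Yinf A = Matrix.of L := hT.limUnder_eq
  rw [hY]
  have h1γ : 0 < 1 - γ := by linarith
  refine ⟨γ, C * 2 / (1 - γ), hγ0, hγ1, by positivity, hT, fun k i j => ?_, fun i i' j => ?_⟩
  · have := dist_le_of_le_geometric_of_tendsto γ _ hγ1 (step i j) (hL i j) k
    rw [Y_eq_pow, Matrix.of_apply, ← Real.dist_eq]
    exact this.trans_eq (by ring)
  · simp only [Matrix.of_apply]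
    set v : Fin n → ℝ := fun r => (1 : Matrix (Fin n) (Fin n) ℝ) i r -
      (1 : Matrix (Fin n) (Fin n) ℝ) i' r with hv
    have hv0 : ∑ r, v r = 0 := by simp [hv, Finset.sum_sub_distrib, Matrix.one_apply]
    have hvk : ∀ k, Matrix.vecMul v (A ^ k) j = (A ^ k) i j - (A ^ k) i' j := by
      intro k
      have : v = (1 : Matrix (Fin n) (Fin n) ℝ) i - (1 : Matrix (Fin n) (Fin n) ℝ) i' := rfl
      rw [this, Matrix.sub_vecMul, Pi.sub_apply, ← Matrix.mul_apply_eq_vecMul,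
        ← Matrix.mul_apply_eq_vecMul, one_mul]
    have h0 : Tendsto (fun k => (A ^ k) i j - (A ^ k) i' j) atTop (𝓝 0) := by
      refine squeeze_zero_norm (a := fun k => C * γ ^ k * ∑ r, |v r|) (fun k => ?_) ?_
      · rw [← hvk, Real.norm_eq_abs]
        exact (Finset.single_le_sum (f := fun j => |Matrix.vecMul v (A ^ k) j|)
          (fun _ _ => abs_nonneg _) (Finset.mem_univ j)).trans (h v hv0 k)
      · simpa using ((tendsto_pow_atTop_nhds_zero_of_lt_one hγ0.le hγ1).const_mul C).mul_const
          (∑ r, |v r|)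
    exact sub_eq_zero.1 (tendsto_nhds_unique ((hL i j).sub (hL i' j)) h0)

/-! ### The limit matrix as an `A`-invariant projection -/

lemma mul_Yinf {n : ℕ} {A : Matrix (Fin n) (Fin n) ℝ}
    (h : Tendsto (Y A) atTop (𝓝 (Yinf A))) : A * Yinf A = Yinf A := by
  refine tendsto_nhds_unique (h.const_mul A) ?_
  simpa only [Y] using (tendsto_add_atTop_iff_nat 1).2 h

lemma Yinf_mul {n : ℕ} {A : Matrix (Fin n) (Fin n) ℝ}
    (h : Tendsto (Y A) atTop (𝓝 (Yinf A))) : Yinf A * A = Yinf A := by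
  refine tendsto_nhds_unique (h.mul_const A) ?_
  have := (tendsto_add_atTop_iff_nat 1).2 h
  simpa only [Y_eq_pow, pow_succ] using this

lemma Yinf_mul_pow {n : ℕ} {A : Matrix (Fin n) (Fin n) ℝ}
    (h : Tendsto (Y A) atTop (𝓝 (Yinf A))) (k : ℕ) : Yinf A * A ^ k = Yinf A := by
  induction k with
  | zero => simp
  | succ k ih => rw [pow_succ, ← mul_assoc, ih, Yinf_mul h]

lemma Yinf_mul_self {n : ℕ} {A : Matrix (Fin n) (Fin n) ℝ}
    (h : Tendsto (Y A) atTop (𝓝 (Yinf A))) : Yinf A * Yinf A = Yinf A := by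
  refine tendsto_nhds_unique (h.const_mul (Yinf A)) ?_
  simp only [Y_eq_pow, Yinf_mul_pow h]
  exact tendsto_const_nhds

lemma tendsto_Y_apply {n : ℕ} {A : Matrix (Fin n) (Fin n) ℝ}
    (h : Tendsto (Y A) atTop (𝓝 (Yinf A))) (i j : Fin n) :
    Tendsto (fun k => Y A k i j) atTop (𝓝 (Yinf A i j)) :=
  tendsto_pi_nhds.1 (tendsto_pi_nhds.1 h i) j

lemma IsWeightMatrix.Yinf_row_sum {n : ℕ} {𝒢 : Digraph (Fin n)} {A : Matrix (Fin n) (Fin n) ℝ}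
    (hA : IsWeightMatrix 𝒢 A) (h : Tendsto (Y A) atTop (𝓝 (Yinf A))) (i : Fin n) :
    ∑ j, Yinf A i j = 1 := by
  refine tendsto_nhds_unique (tendsto_finsetSum _ fun j _ => tendsto_Y_apply h i j) ?_
  simp only [Y_eq_pow, hA.pow_row_sum]
  exact tendsto_const_nhds

/-- Each row of the limit is a nonzero nonnegative vector fixed by `A ^ m`, and a positive `A ^ m`
spreads its mass to every coordinate. -/
lemma IsWeightMatrix.Yinf_pos {n : ℕ} {𝒢 : Digraph (Fin n)} {A : Matrix (Fin n) (Fin n) ℝ}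
    (hA : IsWeightMatrix 𝒢 A) (h𝒢 : StronglyConnected 𝒢)
    (h : Tendsto (Y A) atTop (𝓝 (Yinf A))) (i j : Fin n) : 0 < Yinf A i j := by
  obtain ⟨m, hm⟩ := (hA.eventually_pow_pos h𝒢).exists
  have h0 : ∀ j, 0 ≤ Yinf A i j := fun j => ge_of_tendsto' (tendsto_Y_apply h i j) fun k => by
    rw [Y_eq_pow]; exact hA.pow_nonneg k i j
  obtain ⟨r, hr⟩ : ∃ r, 0 < Yinf A i r := by
    by_contra! hcon
    have := hA.Yinf_row_sum h i
    have h2 := Finset.sum_nonpos fun r (_ : r ∈ Finset.univ) => hcon r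
    linarith
  rw [← Yinf_mul_pow h m, Matrix.mul_apply]
  exact Finset.sum_pos' (fun s _ => mul_nonneg (h0 s) (hm s j).le)
    ⟨r, Finset.mem_univ _, mul_pos hr (hm r j)⟩

/-! ### The spectral norm and the action on stacked vectors -/

section

open scoped Matrix.Norms.L2Operator

lemma norm2_eq_norm {n : ℕ} (M : Matrix (Fin n) (Fin n) ℝ) : norm2 M = ‖M‖ := rfl

lemma norm2_nonneg {n : ℕ} (M : Matrix (Fin n) (Fin n) ℝ) : 0 ≤ norm2 M := norm_nonneg _

lemma norm2_mul_le {n : ℕ} (M P : Matrix (Fin n) (Fin n) ℝ) :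
    norm2 (M * P) ≤ norm2 M * norm2 P := Matrix.l2_opNorm_mul M P

lemma norm2_sub_comm {n : ℕ} (M P : Matrix (Fin n) (Fin n) ℝ) :
    norm2 (M - P) = norm2 (P - M) := norm_sub_rev M P

lemma norm2_sub_le_norm2_sub_add {n : ℕ} (M P Q : Matrix (Fin n) (Fin n) ℝ) :
    norm2 (M - Q) ≤ norm2 (M - P) + norm2 (P - Q) := norm_sub_le_norm_sub_add_norm_sub M P Q

lemma continuous_norm2 {n : ℕ} : Continuous (norm2 : Matrix (Fin n) (Fin n) ℝ → ℝ) := by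
  have : (norm2 : Matrix (Fin n) (Fin n) ℝ → ℝ) = fun M => ‖M‖ := rfl
  rw [this]
  exact continuous_norm

/-- The spectral norm is bounded by a multiple of the largest entry. -/
lemma exists_norm2_le_of_entries (n : ℕ) [NeZero n] : ∃ C : ℝ, 0 < C ∧
    ∀ (M : Matrix (Fin n) (Fin n) ℝ) (b : ℝ), (∀ i j, |M i j| ≤ b) → norm2 M ≤ C * b := by
  refine ⟨1 + ∑ i, ∑ j, ‖(Matrix.single i j 1 : Matrix (Fin n) (Fin n) ℝ)‖, by positivity,
    fun M b hb => ?_⟩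
  have hb0 : 0 ≤ b := (abs_nonneg _).trans (hb 0 0)
  calc norm2 M = ‖∑ i, ∑ j, M i j • (Matrix.single i j 1 : Matrix (Fin n) (Fin n) ℝ)‖ := by
        conv_lhs => rw [norm2_eq_norm, Matrix.matrix_eq_sum_single M]
        simp
    _ ≤ ∑ i, ∑ j, ‖M i j • (Matrix.single i j 1 : Matrix (Fin n) (Fin n) ℝ)‖ :=
        (norm_sum_le _ _).trans (Finset.sum_le_sum fun i _ => norm_sum_le _ _)
    _ ≤ ∑ i, ∑ j, b * ‖(Matrix.single i j 1 : Matrix (Fin n) (Fin n) ℝ)‖ := by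
        refine Finset.sum_le_sum fun i _ => Finset.sum_le_sum fun j _ => ?_
        rw [norm_smul, Real.norm_eq_abs]
        exact mul_le_mul_of_nonneg_right (hb i j) (norm_nonneg _)
    _ ≤ _ := by
        simp only [← Finset.mul_sum]
        rw [add_mul, one_mul, mul_comm]
        linarith

end

/-! ### Matrices acting blockwise on stacked vectors -/

lemma act_apply {n p : ℕ} (M : Matrix (Fin n) (Fin n) ℝ) (v : Stack n p) (i : Fin n) :
    act M v i = ∑ j, M i j • v j := rfl

lemma act_mul {n p : ℕ} (M P : Matrix (Fin n) (Fin n) ℝ) (v : Stack n p) :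
    act (M * P) v = act M (act P v) := by
  ext1 i
  simp only [act_apply, Matrix.mul_apply, Finset.sum_smul, Finset.smul_sum, mul_smul]
  exact Finset.sum_comm

lemma act_one {n p : ℕ} (v : Stack n p) : act 1 v = v := by
  ext1 i
  simp [act_apply, Matrix.one_apply, ite_smul]

lemma act_sub_left {n p : ℕ} (M P : Matrix (Fin n) (Fin n) ℝ) (v : Stack n p) :
    act (M - P) v = act M v - act P v := by
  ext1 i
  simp [act_apply, sub_smul, Finset.sum_sub_distrib]

lemma act_sub {n p : ℕ} (M : Matrix (Fin n) (Fin n) ℝ) (v w : Stack n p) :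
    act M (v - w) = act M v - act M w := by
  ext1 i
  simp [act_apply, smul_sub, Finset.sum_sub_distrib]

lemma act_add {n p : ℕ} (M : Matrix (Fin n) (Fin n) ℝ) (v w : Stack n p) :
    act M (v + w) = act M v + act M w := by
  ext1 i
  simp [act_apply, smul_add, Finset.sum_add_distrib]

lemma act_smul {n p : ℕ} (M : Matrix (Fin n) (Fin n) ℝ) (r : ℝ) (v : Stack n p) :
    act M (r • v) = r • act M v := by
  ext1 i
  simp [act_apply, Finset.smul_sum, smul_comm r]

lemma act_diagonal_apply {n p : ℕ} (w : Fin n → ℝ) (v : Stack n p) (i : Fin n) :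
    act (Matrix.diagonal w) v i = w i • v i := by
  simp [act_apply, Matrix.diagonal_apply, ite_smul]

/-- Regrouped by coordinates, a stack is `p` vectors of `ℝ^n`, and `M` acts on each of them
separately. -/
lemma norm_act_le {n p : ℕ} (M : Matrix (Fin n) (Fin n) ℝ) (v : Stack n p) :
    ‖act M v‖ ≤ norm2 M * ‖v‖ := by
  have sq : ∀ w : Stack n p,
      ‖w‖ ^ 2 = ∑ q, ‖(WithLp.toLp 2 fun j => w j q : EuclideanSpace ℝ (Fin n))‖ ^ 2 := by
    intro w
    simp only [PiLp.norm_sq_eq_of_L2]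
    exact Finset.sum_comm
  refine le_of_sq_le_sq ?_ (mul_nonneg (norm2_nonneg _) (norm_nonneg _))
  rw [mul_pow, sq, sq, Finset.mul_sum]
  refine Finset.sum_le_sum fun q _ => ?_
  rw [← mul_pow]
  refine pow_le_pow_left₀ (norm_nonneg _) ?_ 2
  have h := (Matrix.toEuclideanCLM (𝕜 := ℝ) M).le_opNorm
    (WithLp.toLp 2 fun j => v j q : EuclideanSpace ℝ (Fin n))
  have e : (WithLp.toLp 2 fun j => act M v j q : EuclideanSpace ℝ (Fin n)) =
      Matrix.toEuclideanCLM (𝕜 := ℝ) M (WithLp.toLp 2 fun j => v j q) := by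
    ext i
    simp [act_apply, Matrix.mulVec, dotProduct]
  rw [e]
  exact h

/-! ### Strongly convex functions with Lipschitz gradient -/

lemma descent_of_lipschitz_gradient {E : Type*} [NormedAddCommGroup E] [InnerProductSpace ℝ E]
    [CompleteSpace E] {f : E → ℝ} (hf : Differentiable ℝ f) {l : ℝ}
    (hl : ∀ u v, ‖gradient f u - gradient f v‖ ≤ l * ‖u - v‖) (u v : E) :
    f v ≤ f u + inner ℝ (gradient f u) (v - u) + l / 2 * ‖v - u‖ ^ 2 := by
  set δ := v - u with hδ
  have hγ : ∀ t : ℝ, HasDerivAt (fun t : ℝ => u + t • δ) δ t := fun t => by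
    simpa using ((hasDerivAt_id t).smul_const δ).const_add u
  have hφ : ∀ t : ℝ, HasDerivAt (fun t : ℝ => f (u + t • δ))
      (inner ℝ (gradient f (u + t • δ)) δ) t := fun t => by
    have h1 := (hf (u + t • δ)).hasGradientAt.hasFDerivAt
    exact h1.comp_hasDerivAt t (hγ t)
  -- Up to the constant `f u`, this is the gap between the quadratic upper bound and `f` along the
  -- segment; the Lipschitz bound makes it nondecreasing for `t ≥ 0`.
  have hψ : ∀ t : ℝ, HasDerivAt (fun t : ℝ => t * inner ℝ (gradient f u) δ +
      l / 2 * ‖δ‖ ^ 2 * t ^ 2 - f (u + t • δ))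
      (inner ℝ (gradient f u) δ + l * ‖δ‖ ^ 2 * t - inner ℝ (gradient f (u + t • δ)) δ) t := by
    intro t
    have h2 := ((hasDerivAt_id t).mul_const (inner ℝ (gradient f u) δ)).add
      ((hasDerivAt_pow 2 t).const_mul (l / 2 * ‖δ‖ ^ 2))
    refine (h2.sub (hφ t)).congr_deriv ?_
    simp; ring
  have hmono : MonotoneOn (fun t : ℝ => t * inner ℝ (gradient f u) δ +
      l / 2 * ‖δ‖ ^ 2 * t ^ 2 - f (u + t • δ)) (Set.Ici 0) := by
    refine monotoneOn_of_deriv_nonneg (convex_Ici 0)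
      (fun t _ => (hψ t).continuousAt.continuousWithinAt)
      (fun t _ => (hψ t).differentiableAt.differentiableWithinAt) fun t ht => ?_
    rw [interior_Ici] at ht
    rw [(hψ t).deriv]
    have h3 : inner ℝ (gradient f (u + t • δ) - gradient f u) δ ≤ l * ‖δ‖ ^ 2 * t := by
      refine (real_inner_le_norm _ _).trans ?_
      have h4 := hl (u + t • δ) u
      rw [add_sub_cancel_left, norm_smul, Real.norm_of_nonneg (le_of_lt ht)] at h4
      calc _ ≤ l * (t * ‖δ‖) * ‖δ‖ := mul_le_mul_of_nonneg_right h4 (norm_nonneg _)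
        _ = _ := by ring
    rw [inner_sub_left] at h3
    linarith
  have h5 := hmono (Set.mem_Ici.2 le_rfl) (Set.mem_Ici.2 zero_le_one) zero_le_one
  simp only [zero_mul, zero_smul, one_smul, add_zero, one_mul] at h5
  have h6 : u + δ = v := by rw [hδ]; abel
  rw [h6] at h5
  linarith

/-- Baillon–Haddad for `F - s/2 ‖·‖²`: compare the lower bound from `u` with the upper bound from
`v` at the trial point `v - t D`, then add the same inequality with `u` and `v` exchanged. The best
`t` is `(l - s)⁻¹`; if `l ≤ s`, a large `t` forces `D = 0`. -/
lemma cocoercive_of_quadratic_bounds {E : Type*} [NormedAddCommGroup E] [InnerProductSpace ℝ E]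
    {F : E → ℝ} {g : E → E} {s l : ℝ}
    (hs : ∀ u v, F u + inner ℝ (g u) (v - u) + s / 2 * ‖v - u‖ ^ 2 ≤ F v)
    (hl : ∀ u v, F v ≤ F u + inner ℝ (g u) (v - u) + l / 2 * ‖v - u‖ ^ 2) (u v : E) :
    ‖g v - g u - s • (v - u)‖ ^ 2 ≤ (l - s) * inner ℝ (g v - g u - s • (v - u)) (v - u) := by
  have half : ∀ (u v : E) (t : ℝ), F u - F v + inner ℝ (g u) (v - u) + s / 2 * ‖v - u‖ ^ 2 +
      (t - (l - s) / 2 * t ^ 2) * ‖g v - g u - s • (v - u)‖ ^ 2 ≤ 0 := by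
    intro u v t
    set δ := v - u with hδ
    set D := g v - g u - s • δ with hD
    have h1 := hs u (v - t • D)
    have h2 := hl v (v - t • D)
    have e1 : v - t • D - u = δ - t • D := by rw [hδ]; abel
    have e2 : v - t • D - v = -(t • D) := by abel
    have e3 : inner ℝ (g v) D = inner ℝ (g u) D + s * inner ℝ δ D + ‖D‖ ^ 2 := by
      have : g v = g u + s • δ + D := by rw [hD]; abel
      conv_lhs => rw [this]
      rw [inner_add_left, inner_add_left, real_inner_smul_left, real_inner_self_eq_norm_sq]
    rw [e1, inner_sub_right, inner_smul_right, norm_sub_sq_real, norm_smul, inner_smul_right,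
      mul_pow, Real.norm_eq_abs, sq_abs] at h1
    rw [e2, inner_neg_right, inner_smul_right, norm_neg, norm_smul, mul_pow, Real.norm_eq_abs,
      sq_abs, e3] at h2
    nlinarith
  set δ := v - u with hδ
  set D := g v - g u - s • δ with hD
  have key : ∀ t : ℝ, (2 * t - (l - s) * t ^ 2) * ‖D‖ ^ 2 ≤ inner ℝ D δ := by
    intro t
    have h1 := half u v t
    have h2 := half v u t
    have e1 : u - v = -δ := by rw [hδ]; abel
    have e2 : g u - g v - s • (-δ) = -D := by rw [hD, smul_neg]; abel
    rw [e1, e2, norm_neg, norm_neg, inner_neg_right] at h2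
    have e3 : inner ℝ D δ = inner ℝ (g v) δ - inner ℝ (g u) δ - s * ‖δ‖ ^ 2 := by
      rw [hD, inner_sub_left, inner_sub_left, real_inner_smul_left, real_inner_self_eq_norm_sq]
    rw [← hδ, ← hD] at h1
    rw [e3]
    linarith
  rcases lt_or_ge 0 (l - s) with hM | hM
  · have h := key (l - s)⁻¹
    have e : 2 * (l - s)⁻¹ - (l - s) * (l - s)⁻¹ ^ 2 = (l - s)⁻¹ := by field_simp; ring
    rw [e, inv_mul_le_iff₀ hM] at h
    exact h
  · have hD0 : ‖D‖ ^ 2 = 0 := by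
      by_contra hne
      have hpos : 0 < ‖D‖ ^ 2 := lt_of_le_of_ne (sq_nonneg _) (Ne.symm hne)
      set t : ℝ := (|inner ℝ D δ| + 1) / ‖D‖ ^ 2 with ht
      have h1 : t * ‖D‖ ^ 2 = |inner ℝ D δ| + 1 := div_mul_cancel₀ _ hne
      have h2 := key t
      have h3 : 0 ≤ -(l - s) * t ^ 2 * ‖D‖ ^ 2 := by
        have : 0 ≤ -(l - s) := by linarith
        positivity
      have h4 := le_abs_self (inner ℝ D δ)
      have h5 := abs_nonneg (inner ℝ D δ)
      nlinarith
    have hD1 : D = 0 := by simpa using hD0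
    rw [hD1]; simp

/-- A gradient step with step-size `α` is Lipschitz with constant `max |1 - α l| |1 - α s|`. -/
lemma norm_gradient_step_le {E : Type*} [NormedAddCommGroup E] [InnerProductSpace ℝ E]
    {F : E → ℝ} {g : E → E} {s l : ℝ}
    (hs : ∀ u v, F u + inner ℝ (g u) (v - u) + s / 2 * ‖v - u‖ ^ 2 ≤ F v)
    (hl : ∀ u v, F v ≤ F u + inner ℝ (g u) (v - u) + l / 2 * ‖v - u‖ ^ 2)
    {α : ℝ} (hα : 0 ≤ α) (u v : E) :
    ‖v - u - α • (g v - g u)‖ ≤ max |1 - α * l| |1 - α * s| * ‖v - u‖ := by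
  have h := cocoercive_of_quadratic_bounds hs hl u v
  set δ := v - u with hδ
  set D := g v - g u - s • δ with hD
  -- Completing the square in the cocoercivity inequality places `D` in the ball having the segment
  -- from `0` to `(l - s) δ` as a diameter.
  have hball : ‖D - ((l - s) / 2) • δ‖ ≤ |l - s| / 2 * ‖δ‖ := by
    refine le_of_sq_le_sq ?_ (by positivity)
    rw [norm_sub_sq_real, norm_smul, mul_pow, mul_pow, Real.norm_eq_abs, sq_abs, div_pow, div_pow,
      sq_abs, inner_smul_right]
    linarith
  have e : δ - α • (g v - g u) =
      (1 - α * (s + l) / 2) • δ - α • (D - ((l - s) / 2) • δ) := by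
    have : g v - g u = D + s • δ := by rw [hD]; abel
    rw [this]
    module
  -- The identity `|a + b| / 2 + |a - b| / 2 = max |a| |b|` with `a = 1 - α l`, `b = 1 - α s`.
  have hmax : |1 - α * (s + l) / 2| + α * (|l - s| / 2) = max |1 - α * l| |1 - α * s| := by
    have h1 : α * (|l - s| / 2) = |(1 - α * l) - (1 - α * s)| / 2 := by
      rw [show (1 - α * l) - (1 - α * s) = α * -(l - s) by ring, abs_mul, abs_neg,
        abs_of_nonneg hα]
      ring
    have h2 : |1 - α * (s + l) / 2| = |(1 - α * l) + (1 - α * s)| / 2 := by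
      rw [show (1 - α * l) + (1 - α * s) = 2 * (1 - α * (s + l) / 2) by ring, abs_mul]
      norm_num
    rw [h1, h2]
    generalize 1 - α * l = a
    generalize 1 - α * s = b
    rcases max_cases |a| |b| with h | h <;> rcases abs_cases a with ha | ha <;>
      rcases abs_cases b with hb | hb <;> rcases abs_cases (a + b) with hab | hab <;>
      rcases abs_cases (a - b) with hab' | hab' <;> linarith
  calc ‖δ - α • (g v - g u)‖
      ≤ |1 - α * (s + l) / 2| * ‖δ‖ + α * (|l - s| / 2 * ‖δ‖) := by
        rw [e]
        refine (norm_sub_le _ _).trans ?_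
        rw [norm_smul, norm_smul, Real.norm_eq_abs, Real.norm_of_nonneg hα]
        gcongr
    _ = _ := by rw [← hmax]; ring

/-! ### The sum of the objective functions -/

lemma IsObjective.sum_lower {n p : ℕ} {f : Fin n → EuclideanSpace ℝ (Fin p) → ℝ} {s l : ℝ}
    (hf : IsObjective f s l) (u v : EuclideanSpace ℝ (Fin p)) :
    ∑ i, f i u + inner ℝ (∑ i, gradient (f i) u) (v - u) + (n * s) / 2 * ‖v - u‖ ^ 2 ≤
      ∑ i, f i v := by
  have h : ∀ i, f i u + inner ℝ (gradient (f i) u) (v - u) + s / 2 * ‖v - u‖ ^ 2 ≤ f i v := by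
    intro i
    have := hf.strong i u v
    rw [← neg_sub v u, inner_neg_right, norm_neg] at this
    linarith
  have h2 := Finset.sum_le_sum fun i (_ : i ∈ Finset.univ) => h i
  rw [Finset.sum_add_distrib, Finset.sum_add_distrib, ← sum_inner] at h2
  simp only [Finset.sum_const, Finset.card_univ, Fintype.card_fin, nsmul_eq_mul] at h2
  linarith

lemma IsObjective.sum_upper {n p : ℕ} {f : Fin n → EuclideanSpace ℝ (Fin p) → ℝ} {s l : ℝ}
    (hf : IsObjective f s l) (u v : EuclideanSpace ℝ (Fin p)) :
    ∑ i, f i v ≤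
      ∑ i, f i u + inner ℝ (∑ i, gradient (f i) u) (v - u) + (n * l) / 2 * ‖v - u‖ ^ 2 := by
  have h2 := Finset.sum_le_sum fun i (_ : i ∈ Finset.univ) =>
    descent_of_lipschitz_gradient (hf.differentiable i) (hf.lipschitz i) u v
  rw [Finset.sum_add_distrib, Finset.sum_add_distrib, ← sum_inner] at h2
  simp only [Finset.sum_const, Finset.card_univ, Fintype.card_fin, nsmul_eq_mul] at h2
  linarith

lemma IsObjective.sum_gradient_eq_zero {n p : ℕ} [NeZero n]
    {f : Fin n → EuclideanSpace ℝ (Fin p) → ℝ} {s l : ℝ} (hf : IsObjective f s l)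
    {x : EuclideanSpace ℝ (Fin p)} (hx : IsOptimal f x) : ∑ i, gradient (f i) x = 0 := by
  set g := ∑ i, gradient (f i) x with hg
  have hn : (0 : ℝ) < n := by exact_mod_cast Nat.pos_of_ne_zero (NeZero.ne n)
  have hL : 0 < n * l := mul_pos hn hf.l_pos
  -- A gradient step of size `1 / (n l)` would lower the objective by at least `‖g‖² / (2 n l)`,
  -- which optimality forbids unless `g = 0`.
  have h := (hx (x - (n * l)⁻¹ • g)).trans (hf.sum_upper x (x - (n * l)⁻¹ • g))
  rw [← hg, sub_sub_cancel_left, inner_neg_right, inner_smul_right, norm_neg, norm_smul, mul_pow,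
    real_inner_self_eq_norm_sq, Real.norm_of_nonneg (inv_nonneg.2 hL.le)] at h
  have e : n * l / 2 * ((n * l)⁻¹ ^ 2 * ‖g‖ ^ 2) = (n * l)⁻¹ * ‖g‖ ^ 2 / 2 := by
    field_simp
  rw [e] at h
  have h0 : (n * l)⁻¹ * ‖g‖ ^ 2 ≤ 0 := by linarith
  have h1 : ‖g‖ ^ 2 ≤ 0 := by
    by_contra! hc
    exact absurd h0 (not_le.2 (mul_pos (inv_pos.2 hL) hc))
  simpa using le_antisymm h1 (sq_nonneg _)

/-- The quadratic lower bound at `0` gives coercivity, hence existence; at a minimizer, where the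
gradient vanishes, it gives uniqueness. -/
lemma IsObjective.existsUnique_isOptimal {n p : ℕ} [NeZero n]
    {f : Fin n → EuclideanSpace ℝ (Fin p) → ℝ} {s l : ℝ} (hf : IsObjective f s l) :
    ∃! x : EuclideanSpace ℝ (Fin p), IsOptimal f x := by
  have hn : (0 : ℝ) < n := by exact_mod_cast Nat.pos_of_ne_zero (NeZero.ne n)
  have hS : 0 < n * s := mul_pos hn hf.s_pos
  have hcont : Continuous fun x => ∑ i, f i x :=
    continuous_finsetSum _ fun i _ => (hf.differentiable i).continuous
  have hlim : Tendsto (fun x => ∑ i, f i x) (cocompact _) atTop := by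
    set g := ∑ i, gradient (f i) 0 with hg
    have hr : Tendsto (fun r : ℝ => ∑ i, f i 0 + r * (n * s / 2 * r - ‖g‖)) atTop atTop := by
      refine tendsto_atTop_add_const_left _ _ (tendsto_id.atTop_mul_atTop₀ ?_)
      exact tendsto_atTop_add_const_right _ _ (tendsto_id.const_mul_atTop (by positivity))
    refine tendsto_atTop_mono (fun x => ?_)
      (hr.comp (tendsto_norm_cocompact_atTop (E := EuclideanSpace ℝ (Fin p))))
    have h := hf.sum_lower 0 x
    rw [sub_zero, ← hg] at h
    have h2 := neg_le_of_abs_le (abs_real_inner_le_norm g x)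
    simp only [Function.comp_apply]
    linarith
  obtain ⟨x, hx⟩ := hcont.exists_forall_le hlim
  refine ⟨x, hx, fun w hw => ?_⟩
  have h := hf.sum_lower x w
  rw [hf.sum_gradient_eq_zero hx, inner_zero_left] at h
  have h2 := hw x
  have h3 : n * s / 2 * ‖w - x‖ ^ 2 ≤ 0 := by linarith
  have h4 : ‖w - x‖ ^ 2 ≤ 0 := by
    by_contra! hc
    exact absurd h3 (not_le.2 (by positivity))
  have h5 : ‖w - x‖ = 0 := by simpa using le_antisymm h4 (sq_nonneg _)
  exact sub_eq_zero.1 (norm_eq_zero.1 h5)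

/-! ### Existence of the limits, the suprema and the constants -/

lemma diagPart_inv {n : ℕ} {M : Matrix (Fin n) (Fin n) ℝ} (h : ∀ i, M i i ≠ 0) :
    (diagPart M)⁻¹ = Matrix.diagonal fun i => (M i i)⁻¹ := by
  refine Matrix.inv_eq_right_inv ?_
  rw [diagPart, Matrix.diagonal_mul_diagonal, ← Matrix.diagonal_one]
  congr 1
  ext i
  exact mul_inv_cancel₀ (h i)

lemma isUnit_diagPart {n : ℕ} {M : Matrix (Fin n) (Fin n) ℝ} (h : ∀ i, M i i ≠ 0) :
    IsUnit (diagPart M) := by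
  rw [diagPart, Matrix.isUnit_diagonal, Pi.isUnit_iff]
  exact fun i => (h i).isUnit

lemma IsWeightMatrix.Y_diag_ne_zero {n : ℕ} {𝒢 : Digraph (Fin n)} {A : Matrix (Fin n) (Fin n) ℝ}
    (hA : IsWeightMatrix 𝒢 A) (k : ℕ) (i : Fin n) : Y A k i i ≠ 0 := by
  rw [Y_eq_pow]
  exact (hA.pow_diag_pos k i).ne'

lemma IsWeightMatrix.tendsto_diagPart_inv {n : ℕ} {𝒢 : Digraph (Fin n)}
    {A : Matrix (Fin n) (Fin n) ℝ} (hA : IsWeightMatrix 𝒢 A) (h𝒢 : StronglyConnected 𝒢)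
    (h : Tendsto (Y A) atTop (𝓝 (Yinf A))) :
    Tendsto (fun k => (diagPart (Y A k))⁻¹) atTop (𝓝 ((diagPart (Yinf A))⁻¹)) := by
  have hne : ∀ i, Yinf A i i ≠ 0 := fun i => (hA.Yinf_pos h𝒢 h i i).ne'
  rw [diagPart_inv hne]
  simp only [diagPart_inv (hA.Y_diag_ne_zero _)]
  exact ((continuous_id.matrix_diagonal).tendsto _).comp
    (tendsto_pi_nhds.2 fun i => (tendsto_Y_apply h i i).inv₀ (hne i))

lemma IsWeightMatrix.wellDefined {n : ℕ} {𝒢 : Digraph (Fin n)}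
    {A : Matrix (Fin n) (Fin n) ℝ} (hA : IsWeightMatrix 𝒢 A) (h𝒢 : StronglyConnected 𝒢) :
    WellDefined A := by
  obtain ⟨_, _, _, _, _, h, _⟩ := hA.exists_limit h𝒢
  exact
    { tendsto := h
      isUnit := fun k => isUnit_diagPart (hA.Y_diag_ne_zero k)
      isUnit_inf := isUnit_diagPart fun i => (hA.Yinf_pos h𝒢 h i i).ne'
      bdd := ((continuous_norm2.tendsto _).comp h).bddAbove_range
      bdd_inv := ((continuous_norm2.tendsto _).comp
        (hA.tendsto_diagPart_inv h𝒢 h)).bddAbove_range }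

lemma WellDefined.norm2_Y_inf_le {n : ℕ} {A : Matrix (Fin n) (Fin n) ℝ} (h : WellDefined A) :
    norm2 (Yinf A) ≤ ySup A :=
  le_of_tendsto' ((continuous_norm2.tendsto _).comp h.tendsto) fun k => le_ciSup h.bdd k

lemma WellDefined.norm2_inv_le {n : ℕ} {A : Matrix (Fin n) (Fin n) ℝ} (h : WellDefined A)
    (k : ℕ) : norm2 ((diagPart (Y A k))⁻¹) ≤ yTil A := le_ciSup h.bdd_inv k

lemma WellDefined.yTil_nonneg {n : ℕ} {A : Matrix (Fin n) (Fin n) ℝ} (h : WellDefined A) :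
    0 ≤ yTil A := (norm2_nonneg _).trans (h.norm2_inv_le 0)

lemma WellDefined.ySup_nonneg {n : ℕ} {A : Matrix (Fin n) (Fin n) ℝ} (h : WellDefined A) :
    0 ≤ ySup A := (norm2_nonneg _).trans h.norm2_Y_inf_le

lemma norm2_inv_sub_inv_le {n : ℕ} {P Q : Matrix (Fin n) (Fin n) ℝ} (hP : IsUnit P)
    (hQ : IsUnit Q) : norm2 (P⁻¹ - Q⁻¹) ≤ norm2 P⁻¹ * norm2 (P - Q) * norm2 Q⁻¹ := by
  have e : P⁻¹ - Q⁻¹ = P⁻¹ * (Q - P) * Q⁻¹ := by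
    rw [mul_sub, sub_mul, mul_assoc, Matrix.mul_nonsing_inv Q ((Matrix.isUnit_iff_isUnit_det _).1 hQ),
      Matrix.nonsing_inv_mul P ((Matrix.isUnit_iff_isUnit_det _).1 hP), mul_one, one_mul]
  rw [e, norm2_sub_comm P Q]
  exact (norm2_mul_le _ _).trans (mul_le_mul_of_nonneg_right (norm2_mul_le _ _) (norm2_nonneg _))

/-- `Y_∞` is idempotent and absorbs `A` on both sides, so all cross terms collapse to `Y_∞`. The
exponent starts at one: the zeroth power is `1`, not `1 - Y_∞`. -/
lemma sub_Yinf_pow {n : ℕ} {A : Matrix (Fin n) (Fin n) ℝ}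
    (h : Tendsto (Y A) atTop (𝓝 (Yinf A))) (k : ℕ) :
    (A - Yinf A) ^ (k + 1) = A ^ (k + 1) - Yinf A := by
  induction k with
  | zero => simp
  | succ k ih =>
    rw [pow_succ, ih, sub_mul, mul_sub, mul_sub, Yinf_mul h, Yinf_mul_self h, ← pow_succ]
    have : A ^ (k + 1) * Yinf A = Yinf A := by
      clear ih
      induction k with
      | zero => simpa using mul_Yinf h
      | succ k ih => rw [pow_succ, mul_assoc, mul_Yinf h, ih]
    rw [this, sub_self, sub_zero]

/-- If some power of `B` has spectral norm at most `ρ ^ m`, then `B` contracts with factor `ρ` in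
a norm equivalent to the Euclidean one. -/
lemma exists_adapted_norm {n p : ℕ} {B : Matrix (Fin n) (Fin n) ℝ} {ρ : ℝ} (hρ : 0 < ρ) {m : ℕ}
    (hm : norm2 (B ^ (m + 1)) ≤ ρ ^ (m + 1)) :
    ∃ (N : Seminorm ℝ (Stack n p)) (d : ℝ), 0 < d ∧ (∀ v, ‖v‖ ≤ N v) ∧ (∀ v, N v ≤ d * ‖v‖) ∧
      ∀ v, N (act B v) ≤ ρ * N v := by
  -- In `N v = ∑_{k ≤ m} ρ^(-k) ‖B^k v‖`, applying `B` shifts the sum by one index at the cost of a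
  -- factor `ρ`. The hypothesis on `B ^ (m + 1)` bounds the term leaving at the top by the missing
  -- term `‖v‖`.
  refine ⟨Seminorm.of (fun v => ∑ k ∈ Finset.range (m + 1), (ρ ^ k)⁻¹ * ‖act (B ^ k) v‖)
    (fun v w => ?_) (fun r v => ?_),
    1 + ∑ k ∈ Finset.range (m + 1), (ρ ^ k)⁻¹ * norm2 (B ^ k), ?_, fun v => ?_, fun v => ?_,
    fun v => ?_⟩
  · rw [← Finset.sum_add_distrib]
    refine Finset.sum_le_sum fun k _ => ?_
    rw [act_add, ← mul_add]
    exact mul_le_mul_of_nonneg_left (norm_add_le _ _) (by positivity)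
  · rw [Finset.mul_sum]
    refine Finset.sum_congr rfl fun k _ => ?_
    rw [act_smul, norm_smul]
    ring
  · have : 0 ≤ ∑ k ∈ Finset.range (m + 1), (ρ ^ k)⁻¹ * norm2 (B ^ k) :=
      Finset.sum_nonneg fun k _ => mul_nonneg (by positivity) (norm2_nonneg _)
    linarith
  · change ‖v‖ ≤ ∑ k ∈ Finset.range (m + 1), (ρ ^ k)⁻¹ * ‖act (B ^ k) v‖
    rw [Finset.sum_range_succ']
    simp only [pow_zero, act_one, inv_one, one_mul]
    exact le_add_of_nonneg_left (Finset.sum_nonneg fun k _ => by positivity)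
  · change ∑ k ∈ Finset.range (m + 1), (ρ ^ k)⁻¹ * ‖act (B ^ k) v‖ ≤ _
    rw [add_mul, one_mul, Finset.sum_mul]
    refine le_add_of_nonneg_of_le (norm_nonneg _) (Finset.sum_le_sum fun k _ => ?_)
    rw [mul_assoc]
    exact mul_le_mul_of_nonneg_left (norm_act_le _ _) (by positivity)
  · change ∑ k ∈ Finset.range (m + 1), (ρ ^ k)⁻¹ * ‖act (B ^ k) (act B v)‖ ≤
      ρ * ∑ k ∈ Finset.range (m + 1), (ρ ^ k)⁻¹ * ‖act (B ^ k) v‖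
    have e : ∀ k, (ρ ^ k)⁻¹ * ‖act (B ^ k) (act B v)‖ =
        ρ * ((ρ ^ (k + 1))⁻¹ * ‖act (B ^ (k + 1)) v‖) := by
      intro k
      rw [← act_mul, ← pow_succ, pow_succ ρ]
      field_simp
    simp only [e, ← Finset.mul_sum]
    refine mul_le_mul_of_nonneg_left ?_ hρ.le
    rw [Finset.sum_range_succ, Finset.sum_range_succ']
    refine add_le_add_right ?_ _
    simp only [pow_zero, act_one, inv_one, one_mul]
    rw [inv_mul_le_iff₀ (by positivity)]
    exact (norm_act_le _ _).trans (mul_le_mul_of_nonneg_right hm (norm_nonneg _))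

lemma IsWeightMatrix.exists_isConstants {n p : ℕ} [NeZero n] {𝒢 : Digraph (Fin n)}
    {A : Matrix (Fin n) (Fin n) ℝ} (hA : IsWeightMatrix 𝒢 A) (h𝒢 : StronglyConnected 𝒢) :
    ∃ (N : Seminorm ℝ (Stack n p)) (σ c d γ T : ℝ), IsConstants A N σ c d γ T := by
  have hw := hA.wellDefined h𝒢
  obtain ⟨γ, C, hγ0, hγ1, hC, h, hrate, -⟩ := hA.exists_limit h𝒢
  obtain ⟨K, hK, hnorm⟩ := exists_norm2_le_of_entries n
  have hKC : 0 < K * C := mul_pos hK hC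
  have rate : ∀ k, norm2 (Y A k - Yinf A) ≤ K * C * γ ^ k := fun k => by
    rw [mul_assoc]
    exact hnorm _ _ fun i j => hrate k i j
  have rate_diag : ∀ k, norm2 (diagPart (Y A k) - diagPart (Yinf A)) ≤ K * C * γ ^ k := fun k => by
    rw [mul_assoc]
    refine hnorm _ _ fun i j => ?_
    rw [diagPart, diagPart, Matrix.diagonal_sub, Matrix.diagonal_apply]
    split_ifs
    · exact hrate k i i
    · rw [abs_zero]; positivity
  have rate_inv : ∀ k, norm2 ((diagPart (Y A k))⁻¹ - (diagPart (Yinf A))⁻¹) ≤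
      yTil A ^ 2 * (K * C) * γ ^ k := fun k => by
    have hinf : norm2 ((diagPart (Yinf A))⁻¹) ≤ yTil A :=
      le_of_tendsto' ((continuous_norm2.tendsto _).comp (hA.tendsto_diagPart_inv h𝒢 h))
        hw.norm2_inv_le
    calc _ ≤ _ := norm2_inv_sub_inv_le (hw.isUnit k) hw.isUnit_inf
      _ ≤ yTil A * (K * C * γ ^ k) * yTil A :=
        mul_le_mul (mul_le_mul (hw.norm2_inv_le k) (rate_diag k) (norm2_nonneg _) hw.yTil_nonneg)
          hinf (norm2_nonneg _) (mul_nonneg hw.yTil_nonneg (by positivity))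
      _ = _ := by ring
  -- Any `ρ` strictly between `γ` and `1` serves as `σ`, since `K C γ ^ m ≤ ρ ^ m` for large `m`.
  obtain ⟨ρ, hγρ, hρ1⟩ := exists_between hγ1
  have hρ0 : 0 < ρ := hγ0.trans hγρ
  obtain ⟨m, hm⟩ : ∃ m : ℕ, norm2 ((A - Yinf A) ^ (m + 1)) ≤ ρ ^ (m + 1) := by
    have ht : Tendsto (fun m : ℕ => K * C * (γ / ρ) ^ m) atTop (𝓝 (K * C * 0)) :=
      (tendsto_pow_atTop_nhds_zero_of_lt_one (by positivity)
        ((div_lt_one hρ0).2 hγρ)).const_mul _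
    rw [mul_zero] at ht
    obtain ⟨m, hm⟩ := (((tendsto_add_atTop_iff_nat 1).2 ht).eventually
      (gt_mem_nhds one_pos)).exists
    refine ⟨m, ?_⟩
    rw [sub_Yinf_pow h, ← Y_eq_pow]
    refine (rate _).trans ?_
    rw [div_pow, ← mul_div_assoc, div_lt_one (by positivity)] at hm
    exact hm.le
  obtain ⟨N, d, hd, hN1, hN2, hN3⟩ := exists_adapted_norm (p := p) hρ0 hm
  refine ⟨N, ρ, 1, d, γ, K * C,
    { definite := fun v hv => norm_le_zero_iff.1 (hv ▸ hN1 v)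
      σ_pos := hρ0
      σ_lt_one := hρ1
      contract := fun a => ?_
      c_pos := one_pos
      norm_le := fun v => by simpa using hN1 v
      d_pos := hd
      le_norm := hN2
      γ_pos := hγ0
      γ_lt_one := hγ1
      rate := ⟨K * C, hKC, rate⟩
      T_pos := hKC
      rate_inv := rate_inv
      rate_inv_succ := fun k => ?_ }⟩
  · have e : act A a - act (Yinf A) a = act (A - Yinf A) (a - act (Yinf A) a) := by
      rw [act_sub_left, act_sub, act_sub, ← act_mul, ← act_mul, mul_Yinf h, Yinf_mul_self h]
      abel
    rw [e]
    exact hN3 _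
  · refine (norm2_sub_le_norm2_sub_add _ ((diagPart (Yinf A))⁻¹) _).trans ?_
    rw [norm2_sub_comm (diagPart (Yinf A))⁻¹]
    refine (add_le_add (rate_inv (k + 1)) (rate_inv k)).trans ?_
    have h1 : yTil A ^ 2 * (K * C) * γ ^ (k + 1) ≤ yTil A ^ 2 * (K * C) * γ ^ k :=
      mul_le_mul_of_nonneg_left (pow_le_pow_of_le_one hγ0.le hγ1.le (Nat.le_succ k)) (by positivity)
    linarith

/-! ### The recursion -/

lemma constStack_apply {n p : ℕ} (x : EuclideanSpace ℝ (Fin p)) (i : Fin n) :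
    constStack n x i = x := rfl

lemma norm_constStack {n p : ℕ} (x : EuclideanSpace ℝ (Fin p)) :
    ‖constStack n x‖ = √n * ‖x‖ := by
  rw [PiLp.norm_eq_of_L2]
  simp [constStack_apply]

/-- One factor `√n` comes from Cauchy–Schwarz on the sum, the other from copying it into `n` blocks.
-/
lemma norm_constStack_sum_le {n p : ℕ} (v : Stack n p) :
    ‖constStack n (∑ i, v i)‖ ≤ n * ‖v‖ := by
  refine le_of_sq_le_sq ?_ (by positivity)
  rw [norm_constStack, mul_pow, mul_pow, Real.sq_sqrt (Nat.cast_nonneg n), pow_two (n : ℝ),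
    mul_assoc, PiLp.norm_sq_eq_of_L2 _ v]
  refine mul_le_mul_of_nonneg_left ?_ (Nat.cast_nonneg n)
  refine (pow_le_pow_left₀ (norm_nonneg _) (norm_sum_le Finset.univ fun i => v i) 2).trans ?_
  simpa using sq_sum_le_card_mul_sum_sq (s := (Finset.univ : Finset (Fin n))) (f := fun i => ‖v i‖)

lemma IsObjective.norm_gradStack_sub_le {n p : ℕ} {f : Fin n → EuclideanSpace ℝ (Fin p) → ℝ}
    {s l : ℝ} (hf : IsObjective f s l) (u v : Stack n p) :
    ‖gradStack f u - gradStack f v‖ ≤ l * ‖u - v‖ := by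
  have hl := hf.l_pos
  refine le_of_sq_le_sq ?_ (by positivity)
  rw [mul_pow, PiLp.norm_sq_eq_of_L2, PiLp.norm_sq_eq_of_L2, Finset.mul_sum]
  refine Finset.sum_le_sum fun i _ => ?_
  rw [← mul_pow]
  exact pow_le_pow_left₀ (norm_nonneg _) (hf.lipschitz i (u i) (v i)) 2

lemma xSeq_succ {n p : ℕ} (A : Matrix (Fin n) (Fin n) ℝ)
    (f : Fin n → EuclideanSpace ℝ (Fin p) → ℝ) (α : ℝ) (x₀ : Stack n p) (k : ℕ) :
    xSeq A f α x₀ (k + 1) = act A (xSeq A f α x₀ k) - α • zSeq A f α x₀ k := rfl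

lemma IsWeightMatrix.zSeq_succ {n p : ℕ} {𝒢 : Digraph (Fin n)} {A : Matrix (Fin n) (Fin n) ℝ}
    (hA : IsWeightMatrix 𝒢 A) (f : Fin n → EuclideanSpace ℝ (Fin p) → ℝ) (α : ℝ)
    (x₀ : Stack n p) (k : ℕ) :
    zSeq A f α x₀ (k + 1) = act A (zSeq A f α x₀ k) +
      (act (diagPart (Y A (k + 1)))⁻¹ (gradStack f (xSeq A f α x₀ (k + 1))) -
        act (diagPart (Y A k))⁻¹ (gradStack f (xSeq A f α x₀ k))) := by
  rw [diagPart_inv (hA.Y_diag_ne_zero _), diagPart_inv (hA.Y_diag_ne_zero _), ← add_sub_assoc]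
  ext1 i
  rw [PiLp.sub_apply, PiLp.add_apply, act_diagonal_apply, act_diagonal_apply]
  rfl

/-- Conservation law of gradient tracking: `Y_∞ A = Y_∞` makes the increments telescope, and `Y_0 =
1` matches the start `z_0 = ∇f_0`. -/
lemma IsWeightMatrix.act_Yinf_zSeq {n p : ℕ} {𝒢 : Digraph (Fin n)}
    {A : Matrix (Fin n) (Fin n) ℝ} (hA : IsWeightMatrix 𝒢 A)
    (h : Tendsto (Y A) atTop (𝓝 (Yinf A))) (f : Fin n → EuclideanSpace ℝ (Fin p) → ℝ) (α : ℝ)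
    (x₀ : Stack n p) (k : ℕ) :
    act (Yinf A) (zSeq A f α x₀ k) =
      act (Yinf A) (act (diagPart (Y A k))⁻¹ (gradStack f (xSeq A f α x₀ k))) := by
  induction k with
  | zero =>
    have : (diagPart (Y A 0))⁻¹ = 1 := by
      rw [diagPart_inv (hA.Y_diag_ne_zero 0)]
      simp [Y]
    rw [this, act_one]
    rfl
  | succ k ih =>
    rw [hA.zSeq_succ, act_add, act_sub, ← ih, ← act_mul, Yinf_mul h]
    abel

lemma IsWeightMatrix.act_Yinf_eq_constStack {n p : ℕ} [NeZero n] {𝒢 : Digraph (Fin n)}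
    {A : Matrix (Fin n) (Fin n) ℝ} (hA : IsWeightMatrix 𝒢 A) (h𝒢 : StronglyConnected 𝒢)
    (v : Stack n p) : act (Yinf A) v = constStack n (∑ j, Yinf A 0 j • v j) := by
  obtain ⟨_, _, _, _, _, _, _, hrow⟩ := hA.exists_limit h𝒢
  ext1 i
  rw [act_apply, constStack_apply]
  exact Finset.sum_congr rfl fun j _ => by rw [hrow i 0 j]

/-- With identical rows, column `j` of `Y_∞` is constantly its diagonal entry, so the scaling
removes the bias of the weights `π`. -/
lemma IsWeightMatrix.act_Yinf_diagPart_inv {n p : ℕ} {𝒢 : Digraph (Fin n)}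
    {A : Matrix (Fin n) (Fin n) ℝ} (hA : IsWeightMatrix 𝒢 A) (h𝒢 : StronglyConnected 𝒢)
    (v : Stack n p) :
    act (Yinf A) (act (diagPart (Yinf A))⁻¹ v) = constStack n (∑ j, v j) := by
  obtain ⟨_, _, _, _, _, h, _, hrow⟩ := hA.exists_limit h𝒢
  have hne : ∀ i, Yinf A i i ≠ 0 := fun i => (hA.Yinf_pos h𝒢 h i i).ne'
  ext1 i
  rw [diagPart_inv hne, act_apply, constStack_apply]
  refine Finset.sum_congr rfl fun j _ => ?_
  rw [act_diagonal_apply, smul_smul, hrow i j j, mul_inv_cancel₀ (hne j), one_smul]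

/-- The averaged tracking variable differs from the sum of the gradients by a geometrically small
multiple of the gradients. -/
lemma norm_act_Yinf_inv_sub_le {n p : ℕ} {A : Matrix (Fin n) (Fin n) ℝ} (hw : WellDefined A)
    {N : Seminorm ℝ (Stack n p)} {σ c d γ T : ℝ} (hc : IsConstants A N σ c d γ T) (k : ℕ)
    (g : Stack n p) :
    ‖act (Yinf A) (act (diagPart (Y A k))⁻¹ g) - act (Yinf A) (act (diagPart (Yinf A))⁻¹ g)‖ ≤
      ySup A * yTil A ^ 2 * T * γ ^ k * ‖g‖ := by
  rw [← act_sub, ← act_sub_left]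
  calc _ ≤ norm2 (Yinf A) * (norm2 ((diagPart (Y A k))⁻¹ - (diagPart (Yinf A))⁻¹) * ‖g‖) :=
        (norm_act_le _ _).trans (mul_le_mul_of_nonneg_left (norm_act_le _ _) (norm2_nonneg _))
    _ ≤ ySup A * ((yTil A ^ 2 * T * γ ^ k) * ‖g‖) :=
        mul_le_mul hw.norm2_Y_inf_le
          (mul_le_mul_of_nonneg_right (hc.rate_inv k) (norm_nonneg _))
          (mul_nonneg (norm2_nonneg _) (norm_nonneg _)) hw.ySup_nonneg
    _ = _ := by ring

/-! ### The three rows of the recursion -/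

section

variable {n p : ℕ} {𝒢 : Digraph (Fin n)} {A : Matrix (Fin n) (Fin n) ℝ}
  {f : Fin n → EuclideanSpace ℝ (Fin p) → ℝ} {s l : ℝ} {N : Seminorm ℝ (Stack n p)}
  {σ c d γ T α : ℝ}

lemma consensus_error_succ_le (h : Tendsto (Y A) atTop (𝓝 (Yinf A)))
    (hc : IsConstants A N σ c d γ T) (hα : 0 < α) (x₀ : Stack n p) (k : ℕ) :
    N (xSeq A f α x₀ (k + 1) - act (Yinf A) (xSeq A f α x₀ (k + 1))) ≤
      σ * N (xSeq A f α x₀ k - act (Yinf A) (xSeq A f α x₀ k)) +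
        α * N (zSeq A f α x₀ k - act (Yinf A) (zSeq A f α x₀ k)) := by
  rw [xSeq_succ]
  set x := xSeq A f α x₀ k
  set z := zSeq A f α x₀ k
  have e : act A x - α • z - act (Yinf A) (act A x - α • z) =
      (act A x - act (Yinf A) x) - α • (z - act (Yinf A) z) := by
    rw [act_sub, act_smul, ← act_mul, Yinf_mul h, smul_sub]
    abel
  rw [e]
  refine (map_sub_le_add N _ _).trans (add_le_add (hc.contract x) ?_)
  rw [map_smul_eq_mul, Real.norm_of_nonneg hα.le]

lemma optimality_error_succ_le [NeZero n] (h𝒢 : StronglyConnected 𝒢) (hA : IsWeightMatrix 𝒢 A)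
    (hf : IsObjective f s l) (hc : IsConstants A N σ c d γ T) (hα : 0 < α) (x₀ : Stack n p)
    {xs : EuclideanSpace ℝ (Fin p)} (hxs : IsOptimal f xs) (k : ℕ) :
    ‖act (Yinf A) (xSeq A f α x₀ (k + 1)) - constStack n xs‖ ≤
      α * c * n * l * N (xSeq A f α x₀ k - act (Yinf A) (xSeq A f α x₀ k)) +
        eta n α s l * ‖act (Yinf A) (xSeq A f α x₀ k) - constStack n xs‖ +
        (α * ySup A * yTil A ^ 2 * T) * γ ^ k * ‖gradStack f (xSeq A f α x₀ k)‖ := by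
  have hw := hA.wellDefined h𝒢
  have h := hw.tendsto
  rw [xSeq_succ, act_sub, act_smul, ← act_mul, Yinf_mul h, hA.act_Yinf_zSeq h]
  set x := xSeq A f α x₀ k
  set g := gradStack f x with hg
  set w := ∑ j, Yinf A 0 j • x j with hwdef
  have hx : act (Yinf A) x = constStack n w := hA.act_Yinf_eq_constStack h𝒢 x
  have hl := hf.l_pos
  have step : ‖constStack n w - constStack n xs -
      α • constStack n (∑ i, gradient (f i) w)‖ ≤
        eta n α s l * ‖constStack n w - constStack n xs‖ := by
    have e1 : constStack n w - constStack n xs - α • constStack n (∑ i, gradient (f i) w) =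
        constStack n (w - xs - α • ((∑ i, gradient (f i) w) - ∑ i, gradient (f i) xs)) := by
      rw [hf.sum_gradient_eq_zero hxs, sub_zero]
      rfl
    have e2 : constStack n w - constStack n xs = constStack n (w - xs) := rfl
    rw [e1, e2, norm_constStack, norm_constStack, mul_left_comm]
    refine mul_le_mul_of_nonneg_left ?_ (Real.sqrt_nonneg _)
    have := norm_gradient_step_le hf.sum_lower hf.sum_upper hα.le xs w
    simpa only [eta, mul_assoc] using this
  have lip : ‖constStack n (∑ i, gradient (f i) w) - constStack n (∑ i, g i)‖ ≤
      n * (l * (c * N (x - act (Yinf A) x))) := by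
    have e1 : constStack n (∑ i, gradient (f i) w) - constStack n (∑ i, g i) =
        constStack n (∑ i, (gradStack f (constStack n w) - g) i) := by
      simp only [PiLp.sub_apply, Finset.sum_sub_distrib]
      rfl
    rw [e1]
    refine (norm_constStack_sum_le _).trans (mul_le_mul_of_nonneg_left ?_ (Nat.cast_nonneg n))
    refine (hf.norm_gradStack_sub_le _ _).trans (mul_le_mul_of_nonneg_left ?_ hl.le)
    rw [norm_sub_rev, ← hx]
    exact hc.norm_le _
  have err := norm_act_Yinf_inv_sub_le hw hc k g
  rw [hA.act_Yinf_diagPart_inv h𝒢] at err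
  set u := act (Yinf A) (act (diagPart (Y A k))⁻¹ g)
  rw [hx] at lip ⊢
  -- Exact gradient step at the average, then the error of evaluating gradients at `x` instead of
  -- the average, then the error of scaling by `Y_k` instead of `Y_∞`.
  have e : constStack n w - α • u - constStack n xs =
      (constStack n w - constStack n xs - α • constStack n (∑ i, gradient (f i) w)) +
        α • (constStack n (∑ i, gradient (f i) w) - constStack n (∑ i, g i)) -
        α • (u - constStack n (∑ i, g i)) := by
    module
  rw [e]
  refine (norm_sub_le _ _).trans ((add_le_add_left (norm_add_le _ _) _).trans ?_)
  rw [norm_smul, norm_smul, Real.norm_of_nonneg hα.le]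
  have h1 := mul_le_mul_of_nonneg_left lip hα.le
  have h2 := mul_le_mul_of_nonneg_left err hα.le
  linarith

lemma norm_act_Yinf_zSeq_le [NeZero n] (h𝒢 : StronglyConnected 𝒢) (hA : IsWeightMatrix 𝒢 A)
    (hf : IsObjective f s l) (hc : IsConstants A N σ c d γ T) (x₀ : Stack n p)
    {xs : EuclideanSpace ℝ (Fin p)} (hxs : IsOptimal f xs) (k : ℕ) :
    ‖act (Yinf A) (zSeq A f α x₀ k)‖ ≤
      ySup A * yTil A ^ 2 * T * γ ^ k * ‖gradStack f (xSeq A f α x₀ k)‖ +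
        n * (l * (c * N (xSeq A f α x₀ k - act (Yinf A) (xSeq A f α x₀ k)) +
          ‖act (Yinf A) (xSeq A f α x₀ k) - constStack n xs‖)) := by
  have hw := hA.wellDefined h𝒢
  have hl := hf.l_pos
  rw [hA.act_Yinf_zSeq hw.tendsto]
  set x := xSeq A f α x₀ k
  set g := gradStack f x with hg
  have err := norm_act_Yinf_inv_sub_le hw hc k g
  rw [hA.act_Yinf_diagPart_inv h𝒢] at err
  set u := act (Yinf A) (act (diagPart (Y A k))⁻¹ g)
  have lip : ‖constStack n (∑ i, g i)‖ ≤ n * (l * (c * N (x - act (Yinf A) x) +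
      ‖act (Yinf A) x - constStack n xs‖)) := by
    -- The gradients at the minimizer sum to zero, so subtracting them is free and the Lipschitz
    -- bound applies.
    have e1 : constStack n (∑ i, g i) =
        constStack n (∑ i, (g - gradStack f (constStack n xs)) i) := by
      have : ∑ i, gradStack f (constStack n xs) i = 0 := hf.sum_gradient_eq_zero hxs
      simp only [PiLp.sub_apply, Finset.sum_sub_distrib, this, sub_zero]
    rw [e1]
    refine (norm_constStack_sum_le _).trans (mul_le_mul_of_nonneg_left ?_ (Nat.cast_nonneg n))
    refine (hf.norm_gradStack_sub_le _ _).trans (mul_le_mul_of_nonneg_left ?_ hl.le)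
    exact (norm_sub_le_norm_sub_add_norm_sub _ (act (Yinf A) x) _).trans
      (add_le_add_left (hc.norm_le _) _)
  calc ‖u‖ = ‖(u - constStack n (∑ i, g i)) + constStack n (∑ i, g i)‖ := by
        rw [sub_add_cancel]
    _ ≤ _ := (norm_add_le _ _).trans (add_le_add err lip)

lemma norm_xSeq_succ_sub_le [NeZero n] (h𝒢 : StronglyConnected 𝒢) (hA : IsWeightMatrix 𝒢 A)
    (hf : IsObjective f s l) (hc : IsConstants A N σ c d γ T) (hα : 0 < α) (x₀ : Stack n p)
    {xs : EuclideanSpace ℝ (Fin p)} (hxs : IsOptimal f xs) (k : ℕ) :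
    ‖xSeq A f α x₀ (k + 1) - xSeq A f α x₀ k‖ ≤
      c * (tau A + α * n * l) * N (xSeq A f α x₀ k - act (Yinf A) (xSeq A f α x₀ k)) +
        α * n * l * ‖act (Yinf A) (xSeq A f α x₀ k) - constStack n xs‖ +
        α * c * N (zSeq A f α x₀ k - act (Yinf A) (zSeq A f α x₀ k)) +
        α * ySup A * yTil A ^ 2 * T * γ ^ k * ‖gradStack f (xSeq A f α x₀ k)‖ := by
  have h := (hA.wellDefined h𝒢).tendsto
  have hz := norm_act_Yinf_zSeq_le (α := α) h𝒢 hA hf hc x₀ hxs k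
  rw [xSeq_succ]
  set x := xSeq A f α x₀ k
  set z := zSeq A f α x₀ k
  -- `A - 1` annihilates the range of `Y_∞`, so only the disagreement part of `x` contributes.
  have e : act A x - α • z - x =
      act (A - 1) (x - act (Yinf A) x) - α • ((z - act (Yinf A) z) + act (Yinf A) z) := by
    rw [act_sub_left, act_sub, act_one, ← act_mul, mul_Yinf h, sub_add_cancel]
    abel
  have h1 : ‖act (A - 1) (x - act (Yinf A) x)‖ ≤ tau A * (c * N (x - act (Yinf A) x)) :=
    (norm_act_le _ _).trans (mul_le_mul_of_nonneg_left (hc.norm_le _) (norm2_nonneg _))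
  have h2 : ‖(z - act (Yinf A) z) + act (Yinf A) z‖ ≤ _ :=
    (norm_add_le _ _).trans (add_le_add (hc.norm_le _) hz)
  rw [e]
  refine (norm_sub_le _ _).trans ?_
  rw [norm_smul, Real.norm_of_nonneg hα.le]
  have h3 := mul_le_mul_of_nonneg_left h2 hα.le
  linarith

lemma tracking_error_succ_le [NeZero n] (h𝒢 : StronglyConnected 𝒢) (hA : IsWeightMatrix 𝒢 A)
    (hf : IsObjective f s l) (hc : IsConstants A N σ c d γ T) (hα : 0 < α) (x₀ : Stack n p)
    {xs : EuclideanSpace ℝ (Fin p)} (hxs : IsOptimal f xs) (k : ℕ) :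
    N (zSeq A f α x₀ (k + 1) - act (Yinf A) (zSeq A f α x₀ (k + 1))) ≤
      c * d * eps A * yTil A * l * (tau A + α * n * l) *
          N (xSeq A f α x₀ k - act (Yinf A) (xSeq A f α x₀ k)) +
        α * d * eps A * l ^ 2 * yTil A * n *
          ‖act (Yinf A) (xSeq A f α x₀ k) - constStack n xs‖ +
        (σ + α * c * d * eps A * l * yTil A) *
          N (zSeq A f α x₀ k - act (Yinf A) (zSeq A f α x₀ k)) +
        (α * eps A * yTil A * l * ySup A + 2 * eps A) * d * yTil A ^ 2 * T * γ ^ k *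
          ‖gradStack f (xSeq A f α x₀ k)‖ := by
  have hw := hA.wellDefined h𝒢
  have h := hw.tendsto
  have hl := hf.l_pos
  have hstep := norm_xSeq_succ_sub_le h𝒢 hA hf hc hα x₀ hxs k
  rw [hA.zSeq_succ]
  set x := xSeq A f α x₀ k
  set x' := xSeq A f α x₀ (k + 1)
  set z := zSeq A f α x₀ k
  set u := act (diagPart (Y A (k + 1)))⁻¹ (gradStack f x') -
    act (diagPart (Y A k))⁻¹ (gradStack f x) with hu
  have e : act A z + u - act (Yinf A) (act A z + u) =
      (act A z - act (Yinf A) z) + act (1 - Yinf A) u := by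
    rw [act_add, act_sub_left, act_one, ← act_mul, Yinf_mul h]
    abel
  have hu1 : ‖u‖ ≤ yTil A * (l * ‖x' - x‖) + 2 * yTil A ^ 2 * T * γ ^ k * ‖gradStack f x‖ := by
    -- The change of gradient under the new scaling, controlled by `‖x' - x‖`, plus the change of
    -- scaling on the old gradient, which is geometrically small.
    have e1 : u = act (diagPart (Y A (k + 1)))⁻¹ (gradStack f x' - gradStack f x) +
        act ((diagPart (Y A (k + 1)))⁻¹ - (diagPart (Y A k))⁻¹) (gradStack f x) := by
      rw [hu, act_sub, act_sub_left]
      abel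
    rw [e1]
    refine (norm_add_le _ _).trans (add_le_add ?_ ?_)
    · exact (norm_act_le _ _).trans (mul_le_mul (hw.norm2_inv_le _)
        (hf.norm_gradStack_sub_le _ _) (norm_nonneg _) hw.yTil_nonneg)
    · exact (norm_act_le _ _).trans
        (mul_le_mul_of_nonneg_right (hc.rate_inv_succ k) (norm_nonneg _))
  have hε : 0 ≤ eps A := norm2_nonneg _
  have hd := hc.d_pos.le
  have hN : N (act (1 - Yinf A) u) ≤ d * (eps A * ‖u‖) :=
    (hc.le_norm _).trans (mul_le_mul_of_nonneg_left (norm_act_le _ _) hd)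
  rw [e]
  refine (map_add_le_add N _ _).trans ((add_le_add (hc.contract z) hN).trans ?_)
  have h1 := mul_le_mul_of_nonneg_left
    (mul_le_mul_of_nonneg_left hstep hl.le) hw.yTil_nonneg
  have h2 := mul_le_mul_of_nonneg_left (hu1.trans (add_le_add_left h1 _)) (mul_nonneg hd hε)
  linarith

lemma GMat_nonneg (hw : WellDefined A) (hf : IsObjective f s l) (hc : IsConstants A N σ c d γ T)
    (hα : 0 < α) (i j : Fin 3) : 0 ≤ GMat A α s l σ c d i j := by
  have hε : 0 ≤ eps A := norm2_nonneg _
  have hτ : 0 ≤ tau A := norm2_nonneg _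
  have hy := hw.yTil_nonneg
  have hσ := hc.σ_pos
  have hcp := hc.c_pos
  have hd := hc.d_pos
  have hl := hf.l_pos
  have hη : 0 ≤ eta n α s l := (abs_nonneg _).trans (le_max_left _ _)
  fin_cases i <;> fin_cases j <;> simp [GMat] <;> positivity

end

end DistOpt

open DistOpt
theorem theorem1 {n p : ℕ} [NeZero n] (𝒢 : Digraph (Fin n)) (h𝒢 : StronglyConnected 𝒢)
    (A : Matrix (Fin n) (Fin n) ℝ) (hA : IsWeightMatrix 𝒢 A) :
    -- the limit, the inverses and the suprema that occur in the constants exist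
    WellDefined A ∧
    -- the norm and the remaining constants exist, depending on `A` and `p` only
    (∃ (N : Seminorm ℝ (Stack n p)) (σ c d γ T : ℝ), IsConstants A N σ c d γ T) ∧
    ∀ (f : Fin n → EuclideanSpace ℝ (Fin p) → ℝ) (s l : ℝ), IsObjective f s l →
      -- the optimal solution exists and is unique
      (∃! xs : EuclideanSpace ℝ (Fin p), IsOptimal f xs) ∧
      -- for every choice of these constants, step-size and initial point, the recursion holds
      ∀ (N : Seminorm ℝ (Stack n p)) (σ c d γ T : ℝ), IsConstants A N σ c d γ T →
      ∀ α : ℝ, 0 < α → ∀ (x₀ : Stack n p) (xs : EuclideanSpace ℝ (Fin p)), IsOptimal f xs →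
        (∀ i j, 0 ≤ GMat A α s l σ c d i j) ∧
        ∀ k : ℕ, tVec A N f α x₀ xs (k + 1) ≤
          (GMat A α s l σ c d).mulVec (tVec A N f α x₀ xs k) +
            (HMat A α l d γ T k).mulVec (sVec A f α x₀ k) := by
  have hw := hA.wellDefined h𝒢
  refine ⟨hw, hA.exists_isConstants h𝒢, fun f s l hf => ⟨hf.existsUnique_isOptimal,
    fun N σ c d γ T hc α hα x₀ xs hxs => ⟨GMat_nonneg hw hf hc hα, fun k i => ?_⟩⟩⟩
  fin_cases i
  · have h := consensus_error_succ_le (f := f) hw.tendsto hc hα x₀ k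
    simp [tVec, sVec, GMat, HMat]
    linarith
  · have h := optimality_error_succ_le h𝒢 hA hf hc hα x₀ hxs k
    simp [tVec, sVec, GMat, HMat]
    linarith
  · have h := tracking_error_succ_le h𝒢 hA hf hc hα x₀ hxs k
    simp [tVec, sVec, GMat, HMat]
    linarith
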